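/- Let $p>0$, $\lambda>0$, $0<r<\alpha$ and $\delta>r$. On a complete probability space $(\Omega,\mathcal F,\mathbb P)$ let claims arrive at the epochs $S_1<S_2<\cdots$ of a Poisson process of rate $\lambda$, with i.i.d. nonnegative sizes $U_1,U_2,\dots$ of distribution $F$ that are independent of the arrivals. Put $N(t)=\#\{i: S_i\le t\}$ and $Y_t=\sum_{i=1}^{N(t)}U_i$, and let $(\mathcal F_t)_{t\ge 0}$ be the filtration generated by $Y$ and augmented by the $\mathbb P$-null sets. A dividend process is a process $L=(L_t)_{t\ge0}$ with $L_0=0$ that is $(\mathcal F_t)$-predictable, nondecreasing and left-continuous. Given an initial reserve $x\in\mathbb R$, the reserve controlled by $L$ is the solution $R=R^{x,L}$ of $$R_t=x+\int_0^t\bigl(p+rR_s\mathbf 1_{\{R_s\ge0\}}+\alpha R_s\mathbf 1_{\{R_s<0\}}\bigr)\,ds-Y_t-L_t,\qquad t\ge0,$$ and the time of ruin is $T=T^{x,L}=\inf\{t\ge0: R_t\le -p/\alpha\}$ (with $\inf\emptyset=\infty$). The process $L$ is admissible for $x$ if, almost surely, $L_{t+}-L_t\le\max\{R_t+p/\alpha,\,0\}$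 for all finite $t\le T$; that is, a lump sum dividend never takes the reserve below the critical value $-p/\alpha$. The value function is $$V(x)=\sup_{L\text{ admissible for }x}\ \mathbb E\Bigl[\int_{[0,T]}e^{-\delta s}\,dL_s\Bigr],\qquad x\in\mathbb R,$$ where the integral is a pathwise Lebesgue–Stieltjes integral that includes the lump sums $L_{s+}-L_s$ paid at $s=0$ and at $s=T$ (if $T<\infty$). Then $V(x)<\infty$ for every $x\in\mathbb R$, and $V$ is nonnegative and nondecreasing on $\mathbb R$, continuous on $[-p/\alpha,\infty)$ and locally Lipschitz continuous on $(-p/\alpha,\infty)$. Moreover, $V'(x)$ exists for almost every $x\in(-p/\alpha,\infty)$, and $V'(x)\ge1$ at every $x\in(-p/\alpha,\infty)$ at which $V'(x)$ exists. -/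

import Mathlib

open MeasureTheory ProbabilityTheory Set Filter Topology
open scoped ENNReal NNReal

noncomputable section

namespace AbsoluteRuin

/-- The waiting times between successive epochs: `S 0`, `S 1 - S 0`, `S 2 - S 1`, … -/
def waitingTime {Ω : Type*} (S : ℕ → Ω → ℝ) : ℕ → Ω → ℝ
  | 0 => S 0
  | n + 1 => fun ω => S (n + 1) ω - S n ω

/-- Claims arriving at the epochs of a Poisson process of rate `lam` (independent exponential
waiting times), with independent claim sizes of law `F` that are independent of the arrivals.
Claims are numbered from `0`. -/
structure ClaimModel {Ω : Type*} [MeasurableSpace Ω] (μ : Measure Ω) (lam : ℝ) (F : Measure ℝ) where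
  /-- the arrival epochs -/
  S : ℕ → Ω → ℝ
  /-- the claim sizes -/
  U : ℕ → Ω → ℝ
  measurable_S : ∀ n, Measurable (S n)
  measurable_U : ∀ n, Measurable (U n)
  law_wait : ∀ n, μ.map (waitingTime S n) = expMeasure lam
  indep_wait : iIndepFun (waitingTime S) μ
  law_U : ∀ n, μ.map (U n) = F
  indep_U : iIndepFun U μ
  indep_wait_U : IndepFun (fun ω n => waitingTime S n ω) (fun ω n => U n ω) μ

namespace ClaimModel

variable {Ω : Type*} [MeasurableSpace Ω] {μ : Measure Ω} {lam : ℝ} {F : Measure ℝ}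

/-- `N(t)`, the number of claims up to time `t`. -/
def count (M : ClaimModel μ lam F) (t : ℝ≥0) (ω : Ω) : ℕ := {n : ℕ | M.S n ω ≤ t}.ncard

/-- The aggregate claim amount `Y_t` up to time `t`. -/
def aggregate (M : ClaimModel μ lam F) (t : ℝ≥0) (ω : Ω) : ℝ :=
  ∑ n ∈ Finset.range (M.count t ω), M.U n ω

theorem measurable_count (M : ClaimModel μ lam F) (t : ℝ≥0) : Measurable (M.count t) := by
  change Measurable (fun ω => {n : ℕ | M.S n ω ≤ t}.ncard)
  have h : Measurable fun ω => ∑' n : ℕ, (M.S n ⁻¹' Iic (t : ℝ)).indicator (fun _ => (1 : ℝ≥0∞)) ω :=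
    Measurable.tsum fun n => measurable_const.indicator (M.measurable_S n measurableSet_Iic)
  have h2 : ∀ ω, ∑' n : ℕ, (M.S n ⁻¹' Iic (t : ℝ)).indicator (fun _ => (1 : ℝ≥0∞)) ω
      = ({n : ℕ | M.S n ω ≤ t}.encard : ℝ≥0∞) := fun ω => by
    rw [← Measure.count_apply (MeasurableSet.of_discrete), Measure.count, Measure.sum_apply _ MeasurableSet.of_discrete]
    refine tsum_congr fun n => ?_
    simp [indicator]
  simp only [h2] at h
  refine measurable_to_countable' fun k => ?_
  by_cases hk : k = 0
  · have : (fun ω => {n : ℕ | M.S n ω ≤ t}.ncard) ⁻¹' {k}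
      = (fun ω => ({n : ℕ | M.S n ω ≤ t}.encard : ℝ≥0∞)) ⁻¹' {0, ∞} := by
      ext ω; simp [Set.ncard, hk]
    rw [this]; exact h (by measurability)
  · have : (fun ω => {n : ℕ | M.S n ω ≤ t}.ncard) ⁻¹' {k}
      = (fun ω => ({n : ℕ | M.S n ω ≤ t}.encard : ℝ≥0∞)) ⁻¹' {(k : ℝ≥0∞)} := by
      ext ω
      simp only [Set.ncard, mem_preimage, mem_singleton_iff]
      generalize {n : ℕ | M.S n ω ≤ t}.encard = e
      induction e using ENat.recTopCoe with
      | top => simp [Ne.symm hk]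
      | coe a => simp
    rw [this]; exact h (measurableSet_singleton _)

theorem measurable_aggregate (M : ClaimModel μ lam F) (t : ℝ≥0) : Measurable (M.aggregate t) := by
  have h : Measurable (fun q : ℕ × Ω => ∑ n ∈ Finset.range q.1, M.U n q.2) := by
    refine measurable_from_prod_countable_right fun k => ?_
    exact Finset.measurable_sum (Finset.range k) fun n _ => M.measurable_U n
  exact h.comp ((M.measurable_count t).prodMk measurable_id)

/-- The filtration generated by the aggregate claims, augmented by the null sets. (Probabilities
are taken given a deterministic initial reserve, which adds no information.) -/
def filtration (M : ClaimModel μ lam F) : Filtration ℝ≥0 (inferInstance : MeasurableSpace Ω) where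
  seq t := (⨆ s : Iic t, MeasurableSpace.comap (M.aggregate s) inferInstance) ⊔
    MeasurableSpace.generateFrom {A : Set Ω | MeasurableSet A ∧ μ A = 0}
  mono' s t hst := by
    refine sup_le_sup_right (iSup_le fun u => ?_) _
    exact le_iSup (fun u : Iic t => MeasurableSpace.comap (M.aggregate u) inferInstance)
      ⟨u.1, u.2.trans hst⟩
  le' t := sup_le (iSup_le fun s => (M.measurable_aggregate s).comap_le)
    (MeasurableSpace.generateFrom_le fun _ hA => hA.1)

end ClaimModel

/-- The rate of change of the reserve at level `u` without claims and dividends: premium rate `p`,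
credit interest force `r` for nonnegative reserve, debit interest force `α` for negative reserve. -/
def drift (p r α u : ℝ) : ℝ := p + if 0 ≤ u then r * u else α * u

/-- A cumulative dividend process for the filtration `ℱ`: started at `0`, nondecreasing,
left-continuous (right limits exist by monotonicity) and predictable. -/
structure DividendProcess {Ω : Type*} {m : MeasurableSpace Ω} (ℱ : Filtration ℝ≥0 m) where
  /-- the cumulative dividends `L_t`; a lump sum paid at time `t` is not yet included in `L_t` -/
  paid : ℝ≥0 → Ω → ℝ
  paid_zero : ∀ ω, paid 0 ω = 0
  monotone_paid : ∀ ω, Monotone fun t => paid t ω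
  leftCts_paid : ∀ ω t, ContinuousWithinAt (fun s => paid s ω) (Iic t) t
  predictable_paid : IsStronglyPredictable ℱ paid

namespace DividendProcess

variable {Ω : Type*} {m : MeasurableSpace Ω} {ℱ : Filtration ℝ≥0 m}

/-- The path of the dividend process, extended by `0` to negative times. -/
def path (L : DividendProcess ℱ) (ω : Ω) (t : ℝ) : ℝ := L.paid t.toNNReal ω

theorem monotone_path (L : DividendProcess ℱ) (ω : Ω) : Monotone (L.path ω) :=
  fun _ _ h => L.monotone_paid ω (Real.toNNReal_le_toNNReal h)

/-- The Lebesgue–Stieltjes measure `dL` of a path. It has an atom of mass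
`L_{t+} - L_t` at each jump time `t`, including a lump sum paid at time `0`. -/
def stieltjes (L : DividendProcess ℱ) (ω : Ω) : Measure ℝ :=
  (L.monotone_path ω).stieltjesFunction.measure

/-- The lump sum `L_{t+} - L_t` paid at time `t`. -/
def lumpSum (L : DividendProcess ℱ) (t : ℝ≥0) (ω : Ω) : ℝ :=
  Function.rightLim (L.path ω) t - L.paid t ω

end DividendProcess

section Control

variable {Ω : Type*} [MeasurableSpace Ω] {μ : Measure Ω} {lam : ℝ} {F : Measure ℝ}

/-- `R` is the controlled reserve with initial value `x` under the dividend process `L`, i.e. the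
(up to null sets unique) solution of
`R_t = x + ∫₀ᵗ (p + r R_s 1{R_s ≥ 0} + α R_s 1{R_s < 0}) ds - Y_t - L_t`.
Replacing `R_s` by `R_{s-}` under the `ds`-integral changes it at countably many `s` only. -/
def IsReserve (M : ClaimModel μ lam F) (p r α x : ℝ) (L : DividendProcess M.filtration)
    (R : ℝ≥0 → Ω → ℝ) : Prop :=
  ∀ᵐ ω ∂μ, ∀ t : ℝ≥0,
    IntervalIntegrable (fun s : ℝ => drift p r α (R s.toNNReal ω)) volume 0 t ∧
    R t ω = x + (∫ s in (0 : ℝ)..t, drift p r α (R s.toNNReal ω)) - M.aggregate t ω - L.paid t ω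

/-- The time of absolute ruin, `inf {t ≥ 0 : R_t ≤ -p/α}`, with value `∞` if there is none. -/
def ruinTime (p α : ℝ) (R : ℝ≥0 → Ω → ℝ) (ω : Ω) : ℝ≥0∞ :=
  ⨅ (t : ℝ≥0) (_ : R t ω ≤ -(p / α)), (t : ℝ≥0∞)

/-- `L`, with reserve process `R`, is an admissible strategy given the initial reserve `x`: up to
ruin, a lump sum payment never exceeds the excess of the current reserve over the critical value,
so it does not take the reserve below that value, and nothing is paid
at a time when the reserve is already at or below it. -/
def IsAdmissible (M : ClaimModel μ lam F) (p r α x : ℝ) (L : DividendProcess M.filtration)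
    (R : ℝ≥0 → Ω → ℝ) : Prop :=
  IsReserve M p r α x L R ∧
  ∀ᵐ ω ∂μ, ∀ t : ℝ≥0, (t : ℝ≥0∞) ≤ ruinTime p α R ω → L.lumpSum t ω ≤ max (R t ω + p / α) 0

/-- The return `E_x[∫_{[0,T]} e^{-δ s} dL_s]` of a dividend process with reserve `R`, where `T` is
the time of ruin. Lump sums paid at time `0` and at time `T` are included. -/
def expectedReturn (M : ClaimModel μ lam F) (p α δ : ℝ) (L : DividendProcess M.filtration)
    (R : ℝ≥0 → Ω → ℝ) : ℝ≥0∞ :=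
  ∫⁻ ω, (∫⁻ s in {s : ℝ | 0 ≤ s ∧ ENNReal.ofReal s ≤ ruinTime p α R ω},
    ENNReal.ofReal (Real.exp (-δ * s)) ∂(L.stieltjes ω)) ∂μ

/-- The value function: the supremum of the returns of all admissible strategies. -/
def value (M : ClaimModel μ lam F) (p r α δ x : ℝ) : ℝ≥0∞ :=
  ⨆ (L : DividendProcess M.filtration) (R : ℝ≥0 → Ω → ℝ) (_ : IsAdmissible M p r α x L R),
    expectedReturn M p α δ L R

/-- The value function as a real number; this loses nothing where `value` is finite. -/
def realValue (M : ClaimModel μ lam F) (p r α δ x : ℝ) : ℝ := (value M p r α δ x).toReal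

end Control

end AbsoluteRuin

end

/-! Three estimates on the value function carry the theorem. Write `c = -p/α` for the critical level
and `η = max (x - c) 0`.

Upper bound. The drift lies below both `p + r (u - c)` and, for `u ≥ c`, `α (u - c)`. Since a lump
sum never exceeds the excess of the reserve over `c`, Gronwall bounds the payments up to `min t T`
pathwise by `(η + p t) e^{r t}` and by `η e^{α t}` (`paidThrough_le`). After discounting, the first
bound is integrable because `r < δ`, so `V` is finite; the second vanishes as `η → 0`, so `V = 0` up
to `c` and, by dominated convergence, `V` is continuous at `c` (`value_le_returnBound`,
`tendsto_returnBound_zero`).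

Lower bound on increments. From `y ≥ x ≥ c` one may pay `y - x` at once and continue as from `x`,
whence `V(x) + (y - x) ≤ V(y)` (`value_add_le`). This gives monotonicity, hence differentiability
almost everywhere, and `V' ≥ 1`.

Upper bound on increments. From `x > c` one may wait until the undisturbed reserve reaches `y`, at a
time `t₀ ≤ (y - x) / drift x`, and then use a strategy for `y`. With probability `e^{-lam t₀}` no
claim intervenes, so `e^{-(lam + δ) t₀} V(y) ≤ V(x)` (`exp_mul_value_le_value`), and `e^{-z} ≥ 1 -
z` yields the local Lipschitz bound.

The last estimate is the delicate one: the probability space carries no time shift, so a strategy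
cannot simply be restarted at `t₀`. It is therefore rewritten as a measurable functional of the
sequences of waiting times and claims (`exists_claimSeq_strategy`) and applied to the claims after
`t₀`. By the lack of memory of the exponential law these have the original distribution
(`lintegral_shiftIndex`), and the delayed strategy remains predictable for the augmented filtration
(`delayedDividends`). -/

namespace AbsoluteRuin

/-! ### Gronwall inequalities for discontinuous functions -/

section Gronwall

theorem add_mul_integral_le_mul_exp {φ : ℝ → ℝ} {a b C K : ℝ} (hK : 0 ≤ K)
    (hφ : ∀ u v, IntervalIntegrable φ volume u v)
    (h : ∀ t ∈ Ioc a b, φ t ≤ C + K * ∫ s in a..t, φ s) {t : ℝ} (ht : t ∈ Icc a b) :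
    C + K * ∫ s in a..t, φ s ≤ C * Real.exp (K * (t - a)) := by
  set g : ℝ → ℝ := fun t => C + K * ∫ s in a..t, φ s with hg
  have hgc : Continuous g :=
    continuous_const.add (continuous_const.mul (intervalIntegral.continuous_primitive hφ a))
  -- As `φ` is merely integrable, `g` is continuous but need not be differentiable. Integrating once
  -- more gives a differentiable majorant `G` of `g` with `G' = K g ≤ K G`.
  set G : ℝ → ℝ := fun t => C + K * ∫ s in a..t, g s with hG
  have hGd : ∀ t, HasDerivAt G (K * g t) t := fun t =>
    ((hgc.integral_hasStrictDerivAt a t).hasDerivAt.const_mul K).const_add C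
  have hgG : ∀ t ∈ Icc a b, g t ≤ G t := by
    intro t ht
    have : ∫ s in a..t, φ s ≤ ∫ s in a..t, g s := by
      refine intervalIntegral.integral_mono_on_of_le_Ioo ht.1 (hφ _ _)
        (hgc.intervalIntegrable _ _) fun s hs => h s ⟨hs.1, hs.2.le.trans ht.2⟩
    have := mul_le_mul_of_nonneg_left this hK
    simp only [hg, hG]; linarith
  set v : ℝ → ℝ := fun t => Real.exp (-(K * (t - a))) * G t with hv
  have hvd : ∀ t, HasDerivAt v (Real.exp (-(K * (t - a))) * (K * (g t - G t))) t := by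
    intro t
    have h1 : HasDerivAt (fun t : ℝ => -(K * (t - a))) (-(K * 1)) t :=
      (((hasDerivAt_id t).sub_const a).const_mul K).neg
    refine (h1.exp.mul (hGd t)).congr_deriv ?_
    ring
  have hanti : AntitoneOn v (Icc a b) := by
    refine antitoneOn_of_deriv_nonpos (convex_Icc a b)
      (fun t _ => (hvd t).continuousAt.continuousWithinAt)
      (fun t _ => (hvd t).differentiableAt.differentiableWithinAt) fun t ht' => ?_
    rw [interior_Icc] at ht'
    rw [(hvd t).deriv]
    refine mul_nonpos_of_nonneg_of_nonpos (Real.exp_pos _).le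
      (mul_nonpos_of_nonneg_of_nonpos hK ?_)
    linarith [hgG t ⟨ht'.1.le, ht'.2.le⟩]
  have h1 : v t ≤ v a := hanti ⟨le_rfl, ht.1.trans ht.2⟩ ht ht.1
  have h2 : v a = C := by simp [hv, hG]
  have h3 : G t = v t * Real.exp (K * (t - a)) := by
    simp only [hv]
    rw [mul_right_comm, ← Real.exp_add]; simp
  calc g t ≤ G t := hgG t ht
    _ = v t * Real.exp (K * (t - a)) := h3
    _ ≤ C * Real.exp (K * (t - a)) := by
      rw [← h2]; exact mul_le_mul_of_nonneg_right h1 (Real.exp_pos _).le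

/-- Gronwall's inequality in integral form, for a possibly discontinuous function. -/
theorem le_mul_exp_of_le_add_integral {φ : ℝ → ℝ} {a b C K : ℝ} (hK : 0 ≤ K)
    (hφ : IntervalIntegrable φ volume a b)
    (h : ∀ t ∈ Icc a b, φ t ≤ C + K * ∫ s in a..t, φ s) {t : ℝ} (ht : t ∈ Icc a b) :
    φ t ≤ C * Real.exp (K * (t - a)) := by
  refine (h t ht).trans ?_
  have hab : a ≤ b := ht.1.trans ht.2
  -- Cutting off outside the interval makes the function integrable between all endpoints.
  set ψ : ℝ → ℝ := (Ioc a b).indicator φ with hψ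
  have hint : Integrable ψ :=
    (integrable_indicator_iff measurableSet_Ioc).2 ((intervalIntegrable_iff_integrableOn_Ioc_of_le hab).1 hφ)
  have heq : ∀ u ∈ Icc a b, ∫ s in a..u, ψ s = ∫ s in a..u, φ s := by
    intro u hu
    rw [intervalIntegral.integral_of_le hu.1, intervalIntegral.integral_of_le hu.1]
    refine setIntegral_congr_fun measurableSet_Ioc fun s hs => ?_
    simp only [hψ]
    exact indicator_of_mem (show s ∈ Ioc a b from ⟨hs.1, hs.2.trans hu.2⟩) _
  rw [← heq t ht]
  refine add_mul_integral_le_mul_exp hK (fun u v => hint.intervalIntegrable) (fun u hu => ?_) ht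
  rw [heq u (Ioc_subset_Icc_self hu)]
  simp only [hψ, indicator_of_mem hu]
  exact h u (Ioc_subset_Icc_self hu)

/-- Gronwall with constant `0` for the positive part of `D`. This is the tool for barrier arguments:
`D` measures how far a solution has crossed a level. -/
theorem nonpos_of_le_mul_integral_posPart {D : ℝ → ℝ} {a b K : ℝ} (hK : 0 ≤ K)
    (hD : IntervalIntegrable (fun s => max (D s) 0) volume a b)
    (h : ∀ t ∈ Icc a b, D t ≤ K * ∫ s in a..t, max (D s) 0) {t : ℝ} (ht : t ∈ Icc a b) :
    D t ≤ 0 := by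
  have := le_mul_exp_of_le_add_integral (C := 0) hK hD (fun t ht => by
    rw [zero_add]
    refine max_le (h t ht) (mul_nonneg hK ?_)
    exact intervalIntegral.integral_nonneg ht.1 fun s _ => le_max_right _ _) ht
  rw [zero_mul] at this
  exact (le_max_left _ _).trans this

end Gronwall

/-! ### The reserve equation along a single path -/

/-- The path `ρ` solves `ρ_t = x + ∫₀ᵗ b(ρ_s) ds - f_t`. -/
def IsReservePath (b : ℝ → ℝ) (x : ℝ) (f ρ : ℝ≥0 → ℝ) : Prop :=
  ∀ t : ℝ≥0, IntervalIntegrable (fun s : ℝ => b (ρ s.toNNReal)) volume 0 t ∧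
    ρ t = x + (∫ s in (0 : ℝ)..t, b (ρ s.toNNReal)) - f t

namespace IsReservePath

variable {b : ℝ → ℝ} {x : ℝ} {f ρ : ℝ≥0 → ℝ}

theorem intervalIntegrable_drift (h : IsReservePath b x f ρ) {s t : ℝ} (hs : 0 ≤ s) (ht : 0 ≤ t) :
    IntervalIntegrable (fun s : ℝ => b (ρ s.toNNReal)) volume s t := by
  have h1 := (h s.toNNReal).1
  have h2 := (h t.toNNReal).1
  rw [Real.coe_toNNReal _ hs] at h1
  rw [Real.coe_toNNReal _ ht] at h2
  exact h1.symm.trans h2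

theorem eq_real (h : IsReservePath b x f ρ) {t : ℝ} (ht : 0 ≤ t) :
    ρ t.toNNReal = x + (∫ s in (0 : ℝ)..t, b (ρ s.toNNReal)) - f t.toNNReal := by
  have := (h t.toNNReal).2
  rwa [Real.coe_toNNReal _ ht] at this

theorem sub_eq (h : IsReservePath b x f ρ) {s t : ℝ} (hs : 0 ≤ s) (ht : 0 ≤ t) :
    ρ t.toNNReal - ρ s.toNNReal =
      (∫ u in s..t, b (ρ u.toNNReal)) - (f t.toNNReal - f s.toNNReal) := by
  rw [h.eq_real hs, h.eq_real ht, ← intervalIntegral.integral_add_adjacent_intervals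
    (h.intervalIntegrable_drift le_rfl hs) (h.intervalIntegrable_drift hs ht)]
  ring

theorem continuousOn_integral (h : IsReservePath b x f ρ) (T : ℝ) (hT : 0 ≤ T) :
    ContinuousOn (fun t : ℝ => ∫ s in (0 : ℝ)..t, b (ρ s.toNNReal)) (Icc 0 T) := by
  have := (intervalIntegral.continuousOn_primitive_interval (μ := volume) (a := 0) (b := T)
    (f := fun s : ℝ => b (ρ s.toNNReal)) ?_)
  · rwa [uIcc_of_le hT] at this
  · rw [uIcc_of_le hT, integrableOn_Icc_iff_integrableOn_Ioc]
    exact (intervalIntegrable_iff_integrableOn_Ioc_of_le hT).1 (h.intervalIntegrable_drift le_rfl hT)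

theorem intervalIntegrable (h : IsReservePath b x f ρ) (hf : Monotone f) {s t : ℝ} (hs : 0 ≤ s)
    (hst : s ≤ t) : IntervalIntegrable (fun s : ℝ => ρ s.toNNReal) volume s t := by
  have h0 : IntervalIntegrable (fun u : ℝ => x + (∫ s in (0 : ℝ)..u, b (ρ s.toNNReal))) volume s t := by
    refine ContinuousOn.intervalIntegrable ?_
    rw [uIcc_of_le hst]
    exact continuousOn_const.add
      ((h.continuousOn_integral t (hs.trans hst)).mono (Icc_subset_Icc_left hs))
  have h1 : IntervalIntegrable (fun u : ℝ => f u.toNNReal) volume s t :=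
    (hf.comp fun _ _ h => Real.toNNReal_le_toNNReal h).intervalIntegrable
  refine (h0.sub h1).congr fun u hu => ?_
  rw [uIoc_of_le hst] at hu
  exact (h.eq_real (hs.trans hu.1.le)).symm

/-- The driving path cancels in the difference of two solutions, which is therefore continuous
whatever `f` is. -/
theorem unique {K : ℝ} (hK : 0 ≤ K) (hb : ∀ u v, |b u - b v| ≤ K * |u - v|)
    (h : IsReservePath b x f ρ) {ρ' : ℝ≥0 → ℝ} (h' : IsReservePath b x f ρ') : ρ = ρ' := by
  funext T
  set D : ℝ → ℝ := fun s => |ρ s.toNNReal - ρ' s.toNNReal| with hD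
  have hcont : ContinuousOn D (Icc 0 T) := by
    have := ((h.continuousOn_integral T T.coe_nonneg).sub (h'.continuousOn_integral T T.coe_nonneg)).abs
    refine this.congr fun s hs => ?_
    simp only [hD]
    rw [h.eq_real hs.1, h'.eq_real hs.1]
    simp
  have hint : ∀ t ∈ Icc (0 : ℝ) T, IntervalIntegrable D volume 0 t := fun t ht => by
    refine ContinuousOn.intervalIntegrable ?_
    rw [uIcc_of_le ht.1]
    exact hcont.mono (Icc_subset_Icc_right ht.2)
  have hle : ∀ t ∈ Icc (0 : ℝ) T, D t ≤ 0 + K * ∫ s in (0 : ℝ)..t, D s := by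
    intro t ht
    have e : ρ t.toNNReal - ρ' t.toNNReal =
        ∫ s in (0 : ℝ)..t, (b (ρ s.toNNReal) - b (ρ' s.toNNReal)) := by
      rw [intervalIntegral.integral_sub (h.intervalIntegrable_drift le_rfl ht.1)
        (h'.intervalIntegrable_drift le_rfl ht.1), h.eq_real ht.1, h'.eq_real ht.1]
      ring
    simp only [hD]
    rw [e, zero_add, ← intervalIntegral.integral_const_mul]
    refine (intervalIntegral.abs_integral_le_integral_abs ht.1).trans ?_
    refine intervalIntegral.integral_mono_on ht.1 ?_ ((hint t ht).const_mul K) fun s _ => hb _ _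
    exact ((h.intervalIntegrable_drift le_rfl ht.1).sub
      (h'.intervalIntegrable_drift le_rfl ht.1)).abs
  have := le_mul_exp_of_le_add_integral hK (hint T ⟨T.coe_nonneg, le_rfl⟩) hle
    (⟨T.coe_nonneg, le_rfl⟩ : (T : ℝ) ∈ Icc (0 : ℝ) T)
  simp only [hD, Real.toNNReal_coe, zero_mul] at this
  exact sub_eq_zero.1 (abs_nonpos_iff.1 this)

/-- A solution driven by a nondecreasing path never returns above an absorbing level. -/
theorem le_of_le {K c : ℝ} (hK : 0 ≤ K) (hb : ∀ u, b u ≤ K * max (u - c) 0)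
    (hf : Monotone f) (h : IsReservePath b x f ρ) {s t : ℝ≥0} (hst : s ≤ t) (hs : ρ s ≤ c) :
    ρ t ≤ c := by
  have hst' : (s : ℝ) ≤ t := by exact_mod_cast hst
  have hint : ∀ u : ℝ, (s : ℝ) ≤ u →
      IntervalIntegrable (fun v : ℝ => max (ρ v.toNNReal - c) 0) volume s u := fun u hu => by
    have h1 := (h.intervalIntegrable hf s.coe_nonneg hu).sub (intervalIntegrable_const (c := c))
    exact (intervalIntegrable_iff_integrableOn_Ioc_of_le hu).2
      ((intervalIntegrable_iff_integrableOn_Ioc_of_le hu).1 h1).pos_part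
  have := nonpos_of_le_mul_integral_posPart (D := fun u => ρ u.toNNReal - c) hK
    (hint t hst') (fun u hu => ?_) (⟨hst', le_rfl⟩ : (t : ℝ) ∈ Icc (s : ℝ) t)
  · simpa using this
  · have e := h.sub_eq s.coe_nonneg (s.2.trans hu.1)
    have hfm : f (s : ℝ).toNNReal ≤ f u.toNNReal := hf (Real.toNNReal_le_toNNReal hu.1)
    rw [← intervalIntegral.integral_const_mul]
    have : ∫ v in (s : ℝ)..u, b (ρ v.toNNReal) ≤ ∫ v in (s : ℝ)..u, K * max (ρ v.toNNReal - c) 0 :=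
      intervalIntegral.integral_mono_on hu.1 (h.intervalIntegrable_drift s.coe_nonneg (s.2.trans hu.1))
        ((hint u hu.1).const_mul K) fun v _ => hb _
    simp only [Real.toNNReal_coe] at e hfm
    change ρ u.toNNReal - c ≤ _
    linarith

end IsReservePath

/-! ### Jointly measurable solutions by Picard iteration -/

section Picard

variable {E : Type*}

/-- The Picard iterates for the reserve equation driven by a family of paths. -/
noncomputable def picard (b : ℝ → ℝ) (x : ℝ) (f : ℝ≥0 → E → ℝ) : ℕ → ℝ≥0 → E → ℝ
  | 0, t, e => x - f t e
  | n + 1, t, e => x + (∫ s in (0 : ℝ)..t, b (picard b x f n s.toNNReal e)) - f t e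

variable {b : ℝ → ℝ} {x K : ℝ} {f : ℝ≥0 → E → ℝ}

theorem exists_forall_abs_picard_le (hK : 0 ≤ K) (hb : ∀ u v, |b u - b v| ≤ K * |u - v|)
    (e : E) (hfm : Monotone fun t => f t e) (T : ℝ≥0) (n : ℕ) :
    ∃ D, ∀ t ≤ T, |picard b x f n t e| ≤ D := by
  have hfb : ∀ t ≤ T, |f t e| ≤ max |f 0 e| |f T e| := fun t ht =>
    abs_le_max_abs_abs (hfm (zero_le (a := t))) (hfm ht)
  induction n with
  | zero =>
    refine ⟨|x| + max |f 0 e| |f T e|, fun t ht => ?_⟩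
    exact (abs_sub _ _).trans (add_le_add_right (hfb t ht) _)
  | succ n ih =>
    obtain ⟨D, hD⟩ := ih
    refine ⟨|x| + (|b 0| + K * D) * T + max |f 0 e| |f T e|, fun t ht => ?_⟩
    have hD0 : 0 ≤ D := (abs_nonneg _).trans (hD 0 (zero_le (a := T)))
    have htT : (t : ℝ) ≤ T := by exact_mod_cast ht
    have h1 : ‖∫ s in (0 : ℝ)..t, b (picard b x f n s.toNNReal e)‖ ≤ (|b 0| + K * D) * |(t : ℝ) - 0| := by
      refine intervalIntegral.norm_integral_le_of_norm_le_const fun s hs => ?_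
      rw [uIoc_of_le t.coe_nonneg] at hs
      have hsT : s.toNNReal ≤ T := by
        rw [Real.toNNReal_le_iff_le_coe]; exact hs.2.trans htT
      have h2 := hb (picard b x f n s.toNNReal e) 0
      rw [sub_zero] at h2
      have h3 := mul_le_mul_of_nonneg_left (hD _ hsT) hK
      have h4 := abs_sub_abs_le_abs_sub (b (picard b x f n s.toNNReal e)) (b 0)
      rw [Real.norm_eq_abs]; linarith
    rw [Real.norm_eq_abs, sub_zero, abs_of_nonneg t.coe_nonneg] at h1
    have h2 : (|b 0| + K * D) * (t : ℝ) ≤ (|b 0| + K * D) * T :=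
      mul_le_mul_of_nonneg_left htT (by positivity)
    simp only [picard]
    refine (abs_sub _ _).trans (add_le_add ((abs_add_le _ _).trans ?_) (hfb t ht))
    linarith

variable [MeasurableSpace E]

theorem measurable_picard (hb : Measurable b) (hf : Measurable (Function.uncurry f)) (n : ℕ) :
    Measurable (Function.uncurry (picard b x f n)) := by
  induction n with
  | zero =>
    exact measurable_const.sub hf
  | succ n ih =>
    -- Moving the variable endpoint into an indicator turns the integral into one over all of `ℝ`,
    -- to which measurability of parameter integrals applies.
    have h1 : StronglyMeasurable fun q : ℝ≥0 × E =>
        ∫ s : ℝ, (Ioc (0 : ℝ) q.1).indicator (fun s => b (picard b x f n s.toNNReal q.2)) s := by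
      refine StronglyMeasurable.integral_prod_right (f := fun (q : ℝ≥0 × E) (s : ℝ) =>
        (Ioc (0 : ℝ) q.1).indicator (fun s => b (picard b x f n s.toNNReal q.2)) s) ?_
      refine Measurable.stronglyMeasurable ?_
      have hm : Measurable fun w : (ℝ≥0 × E) × ℝ => b (picard b x f n w.2.toNNReal w.1.2) :=
        hb.comp (ih.comp ((measurable_real_toNNReal.comp measurable_snd).prodMk
          (measurable_snd.comp measurable_fst)))
      have hs : MeasurableSet {w : (ℝ≥0 × E) × ℝ | 0 < w.2 ∧ w.2 ≤ w.1.1} :=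
        (measurableSet_lt measurable_const measurable_snd).inter
          (measurableSet_le measurable_snd
            (measurable_coe_nnreal_real.comp (measurable_fst.comp measurable_fst)))
      exact hm.indicator hs
    have h2 : Function.uncurry (picard b x f (n + 1)) = fun q : ℝ≥0 × E =>
        x + (∫ s : ℝ, (Ioc (0 : ℝ) q.1).indicator (fun s => b (picard b x f n s.toNNReal q.2)) s)
          - f q.1 q.2 := by
      funext ⟨t, e⟩
      simp only [Function.uncurry, picard]
      rw [intervalIntegral.integral_of_le t.coe_nonneg, integral_indicator measurableSet_Ioc]
    rw [h2]
    exact (measurable_const.add h1.measurable).sub hf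

theorem continuous_of_abs_le (hb : ∀ u v, |b u - b v| ≤ K * |u - v|) : Continuous b :=
  (LipschitzWith.of_dist_le' (K := K) fun u v => by
    simpa [Real.dist_eq] using hb u v).continuous

theorem intervalIntegrable_of_abs_le {g : ℝ → ℝ} (hg : Measurable g) {T D : ℝ} (hT : 0 ≤ T)
    (hD : ∀ s ∈ Ioc 0 T, |g s| ≤ D) : IntervalIntegrable g volume 0 T := by
  rw [intervalIntegrable_iff_integrableOn_Ioc_of_le hT]
  refine Measure.integrableOn_of_bounded (M := D) (by simp) hg.aestronglyMeasurable ?_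
  exact (ae_restrict_iff' measurableSet_Ioc).2 (Eventually.of_forall fun s hs => hD s hs)

theorem measurable_drift_picard (hb : Measurable b) (hf : Measurable (Function.uncurry f)) (n : ℕ)
    (e : E) : Measurable fun s : ℝ => b (picard b x f n s.toNNReal e) :=
  hb.comp ((measurable_picard hb hf n).comp (measurable_real_toNNReal.prodMk measurable_const))

/-- The weight `exp (2 K t)` makes the Picard map contract by the factor `1/2` on any bounded time
interval, since `K ∫₀ᵗ exp (2 K s) ds ≤ exp (2 K t) / 2`. The shape `C / 2 / 2 ^ n` is that of the
geometric Cauchy criterion. -/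
theorem exists_forall_abs_picard_sub_le (hK : 0 < K) (hb : ∀ u v, |b u - b v| ≤ K * |u - v|)
    (hf : Measurable (Function.uncurry f)) (e : E) (hfm : Monotone fun t => f t e) (T : ℝ≥0) :
    ∃ C, ∀ n, ∀ t ≤ T, |picard b x f n t e - picard b x f (n + 1) t e| ≤
      C / 2 / 2 ^ n * Real.exp (2 * K * t) := by
  have hbm := (continuous_of_abs_le hb).measurable
  obtain ⟨D0, hD0⟩ := exists_forall_abs_picard_le (x := x) hK.le hb e hfm T 0
  obtain ⟨D1, hD1⟩ := exists_forall_abs_picard_le (x := x) hK.le hb e hfm T 1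
  have hint : ∀ n (t : ℝ≥0), IntervalIntegrable
      (fun s : ℝ => b (picard b x f n s.toNNReal e)) volume 0 t := by
    intro n t
    obtain ⟨D, hD⟩ := exists_forall_abs_picard_le (x := x) hK.le hb e hfm t n
    refine intervalIntegrable_of_abs_le (D := |b 0| + K * D) (measurable_drift_picard hbm hf n e) t.coe_nonneg
      fun s hs => ?_
    have h2 := hb (picard b x f n s.toNNReal e) 0
    rw [sub_zero] at h2
    have h3 := mul_le_mul_of_nonneg_left
      (hD s.toNNReal (by rw [Real.toNNReal_le_iff_le_coe]; exact hs.2)) hK.le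
    have h4 := abs_sub_abs_le_abs_sub (b (picard b x f n s.toNNReal e)) (b 0)
    linarith
  refine ⟨2 * (D0 + D1), fun n => ?_⟩
  have hC : 0 ≤ D0 + D1 := add_nonneg ((abs_nonneg _).trans (hD0 0 (zero_le (a := T))))
    ((abs_nonneg _).trans (hD1 0 (zero_le (a := T))))
  induction n with
  | zero =>
    intro t ht
    have h1 : 1 ≤ Real.exp (2 * K * t) := Real.one_le_exp (by positivity)
    calc _ ≤ |picard b x f 0 t e| + |picard b x f 1 t e| := abs_sub _ _
      _ ≤ D0 + D1 := add_le_add (hD0 t ht) (hD1 t ht)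
      _ ≤ _ := by rw [pow_zero, div_one, mul_div_cancel_left₀ _ two_ne_zero]; nlinarith
  | succ n ih =>
    intro t ht
    have e1 : picard b x f (n + 1) t e - picard b x f (n + 1 + 1) t e =
        ∫ s in (0 : ℝ)..t, (b (picard b x f n s.toNNReal e) -
          b (picard b x f (n + 1) s.toNNReal e)) := by
      rw [intervalIntegral.integral_sub (hint _ _) (hint _ _)]
      simp only [picard]; ring
    have hd : ∀ s : ℝ, HasDerivAt (fun s : ℝ => 2 * (D0 + D1) / 2 / 2 ^ (n + 1) * Real.exp (2 * K * s))
        (K * (2 * (D0 + D1) / 2 / 2 ^ n * Real.exp (2 * K * s))) s := by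
      intro s
      have := (((hasDerivAt_id s).const_mul (2 * K)).exp).const_mul (2 * (D0 + D1) / 2 / 2 ^ (n + 1))
      refine this.congr_deriv ?_
      simp only [id]; rw [pow_succ]; field_simp
    rw [e1]
    refine (intervalIntegral.abs_integral_le_integral_abs t.coe_nonneg).trans ?_
    calc _ ≤ ∫ s in (0 : ℝ)..t, K * (2 * (D0 + D1) / 2 / 2 ^ n * Real.exp (2 * K * s)) := by
          refine intervalIntegral.integral_mono_on t.coe_nonneg ((hint _ _).sub (hint _ _)).abs
            (Continuous.intervalIntegrable (by fun_prop) _ _) fun s hs => ?_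
          refine (hb _ _).trans (mul_le_mul_of_nonneg_left ?_ hK.le)
          have := ih s.toNNReal ((Real.toNNReal_le_iff_le_coe.2 hs.2).trans ht)
          rwa [Real.coe_toNNReal _ hs.1] at this
      _ = 2 * (D0 + D1) / 2 / 2 ^ (n + 1) * Real.exp (2 * K * t) -
          2 * (D0 + D1) / 2 / 2 ^ (n + 1) * Real.exp (2 * K * 0) := by
          refine intervalIntegral.integral_eq_sub_of_hasDerivAt (fun s _ => hd s)
            (Continuous.intervalIntegrable (by fun_prop) _ _)
      _ ≤ _ := by
          have : 0 ≤ 2 * (D0 + D1) / 2 / 2 ^ (n + 1) * Real.exp (2 * K * 0) := by positivity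
          linarith

/-- The reserve equation driven by a jointly measurable family of monotone paths has a jointly
measurable solution. -/
theorem exists_measurable_isReservePath (hK : 0 < K) (hb : ∀ u v, |b u - b v| ≤ K * |u - v|)
    (x : ℝ) (hf : Measurable (Function.uncurry f)) (hfm : ∀ e, Monotone fun t => f t e) :
    ∃ ρ : ℝ≥0 → E → ℝ, Measurable (Function.uncurry ρ) ∧
      ∀ e, IsReservePath b x (fun t => f t e) (fun t => ρ t e) := by
  have hbc := continuous_of_abs_le hb
  have hlim : ∀ t e, ∃ l, Tendsto (fun n => picard b x f n t e) atTop (𝓝 l) := by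
    intro t e
    obtain ⟨C, hC⟩ := exists_forall_abs_picard_sub_le (x := x) hK hb hf e (hfm e) t
    refine cauchySeq_tendsto_of_complete
      (cauchySeq_of_le_geometric_two (C := C * Real.exp (2 * K * t)) fun n => ?_)
    rw [Real.dist_eq]
    refine (hC n t le_rfl).trans (le_of_eq ?_)
    ring
  choose ρ hρ using hlim
  refine ⟨ρ, measurable_of_tendsto_metrizable (f := fun n => Function.uncurry (picard b x f n))
    (fun n => measurable_picard hbc.measurable hf n) ?_, fun e T => ?_⟩
  · rw [tendsto_pi_nhds]
    exact fun q => hρ q.1 q.2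
  obtain ⟨C, hC⟩ := exists_forall_abs_picard_sub_le (x := x) hK hb hf e (hfm e) T
  obtain ⟨D, hD⟩ := exists_forall_abs_picard_le (x := x) hK.le hb e (hfm e) T 0
  have hC0 : 0 ≤ C := by
    have := (abs_nonneg _).trans (hC 0 0 (zero_le (a := T)))
    simp at this; linarith
  set C' := C * Real.exp (2 * K * T) with hC'
  have hdist : ∀ n, ∀ t ≤ T, dist (picard b x f n t e) (ρ t e) ≤ C' / 2 ^ n := by
    intro n t ht
    refine dist_le_of_le_geometric_two_of_tendsto (C := C') (fun n => ?_) (hρ t e) n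
    rw [Real.dist_eq]
    refine (hC n t ht).trans ?_
    have : Real.exp (2 * K * t) ≤ Real.exp (2 * K * T) :=
      Real.exp_le_exp.2 (mul_le_mul_of_nonneg_left (by exact_mod_cast ht) (by positivity))
    calc _ ≤ C / 2 / 2 ^ n * Real.exp (2 * K * T) :=
          mul_le_mul_of_nonneg_left this (by positivity)
      _ = _ := by rw [hC']; ring
  have hC'0 : 0 ≤ C' := by positivity
  have hρb : ∀ t ≤ T, |ρ t e| ≤ D + C' := by
    intro t ht
    have h1 := hdist 0 t ht
    rw [Real.dist_eq, abs_sub_comm, pow_zero, div_one] at h1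
    have h2 := abs_sub_abs_le_abs_sub (ρ t e) (picard b x f 0 t e)
    linarith [hD t ht]
  have hpb : ∀ n, ∀ t ≤ T, |picard b x f n t e| ≤ D + C' + C' := by
    intro n t ht
    have h1 := hdist n t ht
    rw [Real.dist_eq] at h1
    have h2 := abs_sub_abs_le_abs_sub (picard b x f n t e) (ρ t e)
    have h3 : C' / 2 ^ n ≤ C' := div_le_self hC'0 (one_le_pow₀ one_le_two)
    linarith [hρb t ht]
  have hbb : ∀ u M, |u| ≤ M → |b u| ≤ |b 0| + K * M := by
    intro u M hu
    have h2 := hb u 0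
    rw [sub_zero] at h2
    have h3 := mul_le_mul_of_nonneg_left hu hK.le
    have h4 := abs_sub_abs_le_abs_sub (b u) (b 0)
    linarith
  have hmρ : Measurable fun s : ℝ => ρ s.toNNReal e := by
    refine measurable_of_tendsto_metrizable (f := fun n (s : ℝ) => picard b x f n s.toNNReal e)
      (fun n => (measurable_picard hbc.measurable hf n).comp
        (measurable_real_toNNReal.prodMk measurable_const)) ?_
    rw [tendsto_pi_nhds]
    exact fun s => hρ _ _
  refine ⟨intervalIntegrable_of_abs_le (D := |b 0| + K * (D + C')) (hbc.measurable.comp hmρ) T.coe_nonneg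
    fun s hs => hbb _ _ (hρb _ (Real.toNNReal_le_iff_le_coe.2 hs.2)), ?_⟩
  -- The iterates are bounded on `[0, T]` uniformly in `n`, so the recursion passes to the limit by
  -- dominated convergence.
  have hconv : Tendsto (fun n => ∫ s in (0 : ℝ)..T, b (picard b x f n s.toNNReal e)) atTop
      (𝓝 (∫ s in (0 : ℝ)..T, b (ρ s.toNNReal e))) := by
    refine intervalIntegral.tendsto_integral_filter_of_dominated_convergence
      (fun _ => |b 0| + K * (D + C' + C')) (Eventually.of_forall fun n =>
        (measurable_drift_picard hbc.measurable hf n e).aestronglyMeasurable)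
      (Eventually.of_forall fun n => Eventually.of_forall fun s hs => ?_) intervalIntegrable_const
      (Eventually.of_forall fun s _ => (hbc.tendsto _).comp (hρ _ _))
    rw [uIoc_of_le T.coe_nonneg] at hs
    exact hbb _ _ (hpb n _ (Real.toNNReal_le_iff_le_coe.2 hs.2))
  exact tendsto_nhds_unique ((tendsto_add_atTop_iff_nat 1).2 (hρ T e))
    ((hconv.const_add x).sub_const (f T e))

end Picard

/-! ### Ruin, payments and returns along a single path -/

/-- The first time at which the path `ρ` is at or below the level `c`. -/
noncomputable def hittingTime (c : ℝ) (ρ : ℝ≥0 → ℝ) : ℝ≥0∞ := ⨅ (t : ℝ≥0) (_ : ρ t ≤ c), (t : ℝ≥0∞)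

/-- The amount paid up to and including time `t`, for a payment path `l`. -/
noncomputable def paidThrough (l : ℝ≥0 → ℝ) (t : ℝ) : ℝ :=
  Function.rightLim (fun s : ℝ => l s.toNNReal) t

/-- Until the reserve `ρ` hits `c`, no lump sum of `l` exceeds the excess of `ρ` over `c`. -/
def IsAdmissiblePath (c : ℝ) (l ρ : ℝ≥0 → ℝ) : Prop :=
  ∀ t : ℝ≥0, (t : ℝ≥0∞) ≤ hittingTime c ρ → paidThrough l t - l t ≤ max (ρ t - c) 0

/-- The payments of `l` up to and including time `T`, discounted at rate `δ`. -/
noncomputable def discountedReturn (δ : ℝ) (l : ℝ≥0 → ℝ) (T : ℝ≥0∞) : ℝ≥0∞ :=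
  ∫⁻ t in Ioi (0 : ℝ), ENNReal.ofReal (δ * Real.exp (-δ * t)) *
    ENNReal.ofReal (paidThrough l (min (ENNReal.ofReal t) T).toReal)

section Paths

variable {c : ℝ} {l ρ : ℝ≥0 → ℝ}

theorem hittingTime_le {t : ℝ≥0} (h : ρ t ≤ c) : hittingTime c ρ ≤ t :=
  iInf₂_le (f := fun (t : ℝ≥0) (_ : ρ t ≤ c) => (t : ℝ≥0∞)) t h

theorem lt_of_lt_hittingTime {t : ℝ≥0} (h : (t : ℝ≥0∞) < hittingTime c ρ) : c < ρ t := by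
  by_contra! hc
  exact absurd (hittingTime_le hc) (not_le.2 h)

theorem monotone_comp_toNNReal (hl : Monotone l) : Monotone fun s : ℝ => l s.toNNReal :=
  fun _ _ h => hl (Real.toNNReal_le_toNNReal h)

theorem paidThrough_le_of_lt (hl : Monotone l) {s t : ℝ≥0} (h : s < t) : paidThrough l s ≤ l t := by
  have := (monotone_comp_toNNReal hl).rightLim_le (show (s : ℝ) < t by exact_mod_cast h)
  simp only [Real.toNNReal_coe] at this
  exact this

theorem tendsto_paidThrough (hl : Monotone l) (t : ℝ) :
    Tendsto (fun s : ℝ => l s.toNNReal) (𝓝[>] t) (𝓝 (paidThrough l t)) :=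
  (monotone_comp_toNNReal hl).tendsto_rightLim t

theorem paidThrough_eq_of_tendsto {t a : ℝ}
    (h : Tendsto (fun s : ℝ => l s.toNNReal) (𝓝[>] t) (𝓝 a)) : paidThrough l t = a :=
  rightLim_eq_of_tendsto h

theorem paidThrough_nonneg (hl : Monotone l) (h0 : l 0 = 0) (t : ℝ) : 0 ≤ paidThrough l t := by
  have h1 := (monotone_comp_toNNReal hl).le_rightLim (le_refl t)
  have h2 := hl (zero_le (a := t.toNNReal))
  rw [h0] at h2
  exact h2.trans h1

theorem toNNReal_sub_coe (u : ℝ) (t₀ : ℝ≥0) : (u - t₀).toNNReal = u.toNNReal - t₀ := by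
  rcases le_total 0 u with hu | hu
  · lift u to ℝ≥0 using hu
    rw [Real.toNNReal_coe, NNReal.sub_def]
  · rw [Real.toNNReal_of_nonpos hu, Real.toNNReal_of_nonpos (by linarith [t₀.coe_nonneg])]
    simp

theorem paidThrough_delay (hl : Monotone l) (t₀ : ℝ≥0) (t : ℝ) :
    paidThrough (fun s => l (s - t₀)) t = paidThrough l (t - t₀) := by
  refine paidThrough_eq_of_tendsto ?_
  have h : Tendsto (fun s : ℝ => s - t₀) (𝓝[>] t) (𝓝[>] (t - t₀)) := by
    refine tendsto_nhdsWithin_iff.2 ⟨?_, ?_⟩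
    · exact ((continuous_id.sub continuous_const).tendsto t).mono_left nhdsWithin_le_nhds
    · filter_upwards [self_mem_nhdsWithin] with s hs
      exact sub_lt_sub_right (mem_Ioi.1 hs) _
  refine ((tendsto_paidThrough hl (t - t₀)).comp h).congr fun s => ?_
  simp [toNNReal_sub_coe]

theorem paidThrough_add_const (hl : Monotone l) (a : ℝ) {t : ℝ} (ht : 0 ≤ t) :
    paidThrough (fun s => l s + if 0 < s then a else 0) t = paidThrough l t + a := by
  refine paidThrough_eq_of_tendsto (((tendsto_paidThrough hl t).add_const a).congr' ?_)
  filter_upwards [self_mem_nhdsWithin] with s hs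
  have : 0 < s.toNNReal := Real.toNNReal_pos.2 (ht.trans_lt hs)
  simp [this]

theorem lintegral_Ioi_exp {δ : ℝ} (hδ : 0 < δ) (s : ℝ) :
    ∫⁻ t in Ioi s, ENNReal.ofReal (δ * Real.exp (-δ * t)) = ENNReal.ofReal (Real.exp (-δ * s)) := by
  rw [← ofReal_integral_eq_lintegral_ofReal
    ((integrableOn_exp_mul_Ioi (neg_lt_zero.2 hδ) s).const_mul δ)
    (Eventually.of_forall fun t => by positivity), integral_const_mul,
    integral_exp_mul_Ioi (neg_lt_zero.2 hδ)]
  congr 1; field_simp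

/-- Write `e^{-δ s} = ∫_s^∞ δ e^{-δ t} dt` and exchange the integrals. Afterwards no Stieltjes
measure occurs: returns can be compared through pointwise bounds on `paidThrough`, and are visibly
measurable in parameters. -/
theorem lintegral_stieltjes_eq_discountedReturn {δ : ℝ} (hδ : 0 < δ) (hl : Monotone l)
    (h0 : l 0 = 0) (T : ℝ≥0∞) :
    ∫⁻ s in {s : ℝ | 0 ≤ s ∧ ENNReal.ofReal s ≤ T}, ENNReal.ofReal (Real.exp (-δ * s))
      ∂(monotone_comp_toNNReal hl).stieltjesFunction.measure = discountedReturn δ l T := by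
  set ν := (monotone_comp_toNNReal hl).stieltjesFunction.measure with hν
  set A : Set ℝ := {s : ℝ | 0 ≤ s ∧ ENNReal.ofReal s ≤ T} with hA
  have hAm : MeasurableSet A :=
    (measurableSet_le measurable_const measurable_id).inter
      (measurableSet_le ENNReal.measurable_ofReal measurable_const)
  set h : ℝ → ℝ≥0∞ := fun t => ENNReal.ofReal (δ * Real.exp (-δ * t)) with hh
  have hhm : Measurable h := by fun_prop
  have step1 : ∀ s ∈ A, ENNReal.ofReal (Real.exp (-δ * s)) =
      ∫⁻ t in Ioi (0 : ℝ), (Ici s).indicator h t := by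
    intro s hs
    rw [setLIntegral_indicator measurableSet_Ici, ← lintegral_Ioi_exp hδ]
    refine setLIntegral_congr ?_
    have : ∀ᵐ t : ℝ, t ≠ s := by simp [ae_iff, measure_singleton]
    filter_upwards [this] with t ht
    refine propext ⟨fun h => ⟨le_of_lt h, hs.1.trans_lt h⟩, fun h => lt_of_le_of_ne h.1 ht.symm⟩
  rw [setLIntegral_congr_fun hAm step1]
  have hjm : Measurable (Function.uncurry fun (s t : ℝ) => (Ici s).indicator h t) := by
    have : (Function.uncurry fun (s t : ℝ) => (Ici s).indicator h t) =
        {q : ℝ × ℝ | q.1 ≤ q.2}.indicator fun q => h q.2 := by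
      funext ⟨s, t⟩; simp [indicator]
    rw [this]
    exact (hhm.comp measurable_snd).indicator (measurableSet_le measurable_fst measurable_snd)
  rw [lintegral_lintegral_swap hjm.aemeasurable]
  refine setLIntegral_congr_fun measurableSet_Ioi fun t ht => ?_
  have e1 : (fun s => (Ici s).indicator h t) = (Iic t).indicator fun _ => h t := by
    funext s; simp [indicator]
  simp only [e1]
  rw [setLIntegral_indicator measurableSet_Iic, setLIntegral_const]
  congr 1
  have e2 : Iic t ∩ A = Icc 0 (min (ENNReal.ofReal t) T).toReal := by
    ext s
    have hfin : min (ENNReal.ofReal t) T ≠ ∞ := ((min_le_left _ _).trans_lt ENNReal.ofReal_lt_top).ne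
    constructor
    · rintro ⟨h1, h2, h3⟩
      refine ⟨h2, (ENNReal.ofReal_le_iff_le_toReal hfin).1 (le_min ?_ h3)⟩
      exact ENNReal.ofReal_le_ofReal h1
    · rintro ⟨h1, h2⟩
      have h3 := (ENNReal.ofReal_le_iff_le_toReal hfin).2 h2
      exact ⟨(ENNReal.ofReal_le_ofReal_iff (le_of_lt ht)).1 (h3.trans (min_le_left _ _)), h1,
        h3.trans (min_le_right _ _)⟩
  -- The path is extended by `l 0 = 0` to negative times, so the mass of `[0, u]` includes the lump
  -- sum at time `0`.
  have e3 : Function.leftLim (monotone_comp_toNNReal hl).stieltjesFunction 0 = 0 := by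
    refine leftLim_eq_of_tendsto ?_
    refine tendsto_const_nhds.congr' ?_
    filter_upwards [self_mem_nhdsWithin] with s hs
    rw [mem_Iio] at hs
    rw [Monotone.stieltjesFunction_eq]
    refine (rightLim_eq_of_tendsto ?_).symm
    refine tendsto_const_nhds.congr' ?_
    filter_upwards [nhdsWithin_le_nhds (Iio_mem_nhds hs)] with u hu
    rw [Real.toNNReal_of_nonpos (le_of_lt hu), h0]
  rw [e2, hν, StieltjesFunction.measure_Icc, e3, sub_zero]
  rfl

theorem exp_mul_const_integral (K B t : ℝ) :
    K * ∫ s in (0 : ℝ)..t, B * Real.exp (K * s) = B * Real.exp (K * t) - B := by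
  have hd : ∀ s : ℝ, HasDerivAt (fun s : ℝ => B * Real.exp (K * s)) (K * (B * Real.exp (K * s))) s := by
    intro s
    refine ((((hasDerivAt_id s).const_mul K).exp).const_mul B).congr_deriv ?_
    simp only [id]; ring
  rw [← intervalIntegral.integral_const_mul,
    intervalIntegral.integral_eq_sub_of_hasDerivAt (fun s _ => hd s)
      (Continuous.intervalIntegrable (by fun_prop) _ _)]
  simp

/-- Pathwise bound for the payments of an admissible strategy until ruin. -/
theorem paidThrough_le {b : ℝ → ℝ} {x A K : ℝ} {y : ℝ≥0 → ℝ} (hA : 0 ≤ A) (hK : 0 ≤ K)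
    (hb : ∀ u, c ≤ u → b u ≤ A + K * (u - c)) (hy : Monotone y) (hy0 : 0 ≤ y 0) (hl : Monotone l)
    (hl0 : l 0 = 0) (hlc : ∀ t, ContinuousWithinAt l (Iic t) t)
    (h : IsReservePath b x (fun t => y t + l t) ρ) (hadm : IsAdmissiblePath c l ρ) {t : ℝ≥0}
    (ht : (t : ℝ≥0∞) ≤ hittingTime c ρ) :
    paidThrough l t ≤ (max (x - c) 0 + A * t) * Real.exp (K * t) := by
  have hf : Monotone fun t => y t + l t := hy.add hl
  have hlt : ∀ t : ℝ≥0, (t : ℝ≥0∞) ≤ hittingTime c ρ → ∀ s : ℝ≥0, s < t → c < ρ s := fun t ht s hs =>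
    lt_of_lt_hittingTime ((by exact_mod_cast hs : (s : ℝ≥0∞) < t).trans_le ht)
  have hint : ∀ t : ℝ, 0 ≤ t → IntervalIntegrable (fun s : ℝ => ρ s.toNNReal - c) volume 0 t :=
    fun t ht => (h.intervalIntegrable hf le_rfl ht).sub intervalIntegrable_const
  -- The linear drift bound is available only before the hitting time. It is used on the open
  -- interval, so `t` may be the hitting time itself.
  have claim1 : ∀ t : ℝ≥0, (t : ℝ≥0∞) ≤ hittingTime c ρ →
      ρ t - c + l t ≤ max (x - c) 0 + A * t + K * ∫ s in (0 : ℝ)..t, (ρ s.toNNReal - c) := by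
    intro t ht
    have h1 := (h t).2
    have h2 : ∫ s in (0 : ℝ)..t, b (ρ s.toNNReal) ≤
        ∫ s in (0 : ℝ)..t, (A + K * (ρ s.toNNReal - c)) := by
      refine intervalIntegral.integral_mono_on_of_le_Ioo t.coe_nonneg (h t).1
        (intervalIntegrable_const.add ((hint t t.coe_nonneg).const_mul K)) fun s hs => hb _ ?_
      exact (hlt t ht _ ((Real.toNNReal_lt_iff_lt_coe hs.1.le).2 hs.2)).le
    rw [intervalIntegral.integral_add intervalIntegrable_const
      ((hint t t.coe_nonneg).const_mul K), intervalIntegral.integral_const_mul,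
      intervalIntegral.integral_const, sub_zero, smul_eq_mul] at h2
    have h3 : 0 ≤ y t := hy0.trans (hy (zero_le (a := t)))
    have h4 := le_max_left (x - c) 0
    linarith
  have hl_nonneg : ∀ t, 0 ≤ l t := fun t => hl0 ▸ hl (zero_le (a := t))
  have claim3 : ∀ t : ℝ≥0, (t : ℝ≥0∞) ≤ hittingTime c ρ →
      ρ t - c + l t ≤ (max (x - c) 0 + A * t) * Real.exp (K * t) := by
    -- The constant `B` is frozen at the final time. Dropping the payments gives Gronwall for `ρ -
    -- c` alone; inserting the result into `claim1` recovers them.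
    intro t ht
    set B := max (x - c) 0 + A * t with hB
    have claim2 : ∀ s : ℝ≥0, s < t → ρ s - c ≤ B * Real.exp (K * s) := by
      intro s hs
      have := le_mul_exp_of_le_add_integral (φ := fun s : ℝ => ρ s.toNNReal - c) (C := B) hK
        (hint s s.coe_nonneg) (fun u hu => ?_) (⟨s.coe_nonneg, le_rfl⟩ : (s : ℝ) ∈ Icc (0 : ℝ) s)
      · simpa using this
      · have hus : u.toNNReal < t := (Real.toNNReal_le_iff_le_coe.2 hu.2).trans_lt hs
        have hut : (u.toNNReal : ℝ≥0∞) ≤ hittingTime c ρ :=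
          (by exact_mod_cast hus.le : (u.toNNReal : ℝ≥0∞) ≤ t).trans ht
        have h1 := claim1 _ hut
        rw [Real.coe_toNNReal _ hu.1] at h1
        have h2 : A * u ≤ A * t := mul_le_mul_of_nonneg_left
          (hu.2.trans (by exact_mod_cast hs.le)) hA
        have h3 := hl_nonneg u.toNNReal
        simp only [hB]
        linarith
    have h1 : ∫ s in (0 : ℝ)..t, (ρ s.toNNReal - c) ≤ ∫ s in (0 : ℝ)..t, B * Real.exp (K * s) := by
      refine intervalIntegral.integral_mono_on_of_le_Ioo t.coe_nonneg (hint t t.coe_nonneg)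
        (Continuous.intervalIntegrable (by fun_prop) _ _) fun s hs => ?_
      have := claim2 s.toNNReal ((Real.toNNReal_lt_iff_lt_coe hs.1.le).2 hs.2)
      rwa [Real.coe_toNNReal _ hs.1.le] at this
    have h2 := mul_le_mul_of_nonneg_left h1 hK
    rw [exp_mul_const_integral] at h2
    linarith [claim1 t ht]
  have hmono : ∀ s : ℝ≥0, s ≤ t → (max (x - c) 0 + A * s) * Real.exp (K * s) ≤
      (max (x - c) 0 + A * t) * Real.exp (K * t) := by
    intro s hs
    have hs' : (s : ℝ) ≤ t := by exact_mod_cast hs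
    have := le_max_right (x - c) 0
    gcongr
  -- If `ρ t > c`, the lump sum at `t` is at most `ρ t - c`, and `claim3` bounds `ρ t - c + l t`. If
  -- `ρ t ≤ c`, no lump sum is allowed, and the bound is carried from earlier times to `t` by left
  -- continuity.
  rcases lt_or_ge c (ρ t) with hρ | hρ
  · have h1 := hadm t ht
    rw [max_eq_left (by linarith)] at h1
    linarith [claim3 t ht]
  · have h1 := hadm t ht
    rw [max_eq_right (by linarith)] at h1
    refine (sub_nonpos.1 h1).trans ?_
    rcases eq_or_ne t 0 with rfl | ht0
    · rw [hl0]
      have := le_max_right (x - c) 0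
      positivity
    · have : (𝓝[<] t).NeBot := nhdsLT_neBot_of_exists_lt ⟨0, pos_iff_ne_zero.2 ht0⟩
      refine le_of_tendsto ((hlc t).mono_left (nhdsWithin_mono _ Iio_subset_Iic_self)) ?_
      filter_upwards [self_mem_nhdsWithin] with s hs
      have h2 := claim3 s ((by exact_mod_cast le_of_lt hs : (s : ℝ≥0∞) ≤ t).trans ht)
      have h3 := hlt t ht s hs
      linarith [hmono s (le_of_lt hs)]

/-- Before ruin, lump sums are admissible as soon as the reserve does not fall below `c`. -/
theorem paidThrough_sub_le_of_lt_hittingTime {b : ℝ → ℝ} {x : ℝ} {y : ℝ≥0 → ℝ} (hy : Monotone y)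
    (hl : Monotone l) (h : IsReservePath b x (fun t => y t + l t) ρ) {t : ℝ≥0}
    (ht : (t : ℝ≥0∞) < hittingTime c ρ) : paidThrough l t - l t ≤ ρ t - c := by
  obtain ⟨T, htT, hT⟩ := ENNReal.lt_iff_exists_nnreal_btwn.1 ht
  have htT' : t < T := by exact_mod_cast htT
  have htT'' : (t : ℝ) < T := by exact_mod_cast htT
  -- For `u` slightly above `t` the reserve still exceeds `c` and claims only lower it, so this
  -- expression dominates `l u`; then `u` tends to `t`.
  have hcont : Tendsto (fun u : ℝ => l t + (ρ t - c) + ((∫ s in (0 : ℝ)..u, b (ρ s.toNNReal)) -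
      ∫ s in (0 : ℝ)..t, b (ρ s.toNNReal))) (𝓝[>] (t : ℝ)) (𝓝 (l t + (ρ t - c) + 0)) := by
    refine Tendsto.const_add _ ?_
    have h1 := (h.continuousOn_integral T T.coe_nonneg) t ⟨t.coe_nonneg, htT''.le⟩
    have h2 : 𝓝[>] (t : ℝ) ≤ 𝓝[Icc (0 : ℝ) (T : ℝ)] (t : ℝ) := by
      rw [← nhdsWithin_Ioc_eq_nhdsGT htT'']
      exact nhdsWithin_mono _ fun u hu => ⟨t.coe_nonneg.trans hu.1.le, hu.2⟩
    have h3 := (h1.tendsto.mono_left h2).sub_const (∫ s in (0 : ℝ)..t, b (ρ s.toNNReal))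
    rwa [sub_self] at h3
  rw [sub_le_iff_le_add', ← add_zero (l t + (ρ t - c))]
  refine le_of_tendsto_of_tendsto (tendsto_paidThrough hl t) hcont ?_
  filter_upwards [Ioo_mem_nhdsGT htT''] with u hu
  have hu0 : 0 ≤ u := t.coe_nonneg.trans hu.1.le
  have h1 := h.eq_real hu0
  have h2 := (h t).2
  have h3 : y t ≤ y u.toNNReal := hy (NNReal.le_toNNReal_of_coe_le hu.1.le)
  have h4 : c < ρ u.toNNReal := lt_of_lt_hittingTime (lt_trans (by
    exact_mod_cast (Real.toNNReal_lt_iff_lt_coe hu0).2 hu.2) hT)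
  linarith

end Paths

/-! ### Waiting until a fixed time, then restarting -/

section Concatenation

variable {b : ℝ → ℝ} {x y c : ℝ} {f g ψ ρ : ℝ≥0 → ℝ} {t₀ : ℝ≥0}

/-- Follow `ψ` up to time `t₀`, then `ρ` delayed by `t₀`. -/
noncomputable def concat (t₀ : ℝ≥0) (ψ ρ : ℝ≥0 → ℝ) (t : ℝ≥0) : ℝ :=
  if t ≤ t₀ then ψ t else ρ (t - t₀)

theorem isReservePath_concat (hψ : IsReservePath b x (fun _ => 0) ψ) (hy : ψ t₀ = y)
    (hρ : IsReservePath b y g ρ) (hf0 : ∀ t ≤ t₀, f t = 0) (hf1 : ∀ s, f (t₀ + s) = g s) :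
    IsReservePath b x f (concat t₀ ψ ρ) := by
  have hL : ∀ s : ℝ, s ≤ t₀ → concat t₀ ψ ρ s.toNNReal = ψ s.toNNReal := fun s hs =>
    if_pos (Real.toNNReal_le_iff_le_coe.2 hs)
  have hR : ∀ s : ℝ, t₀ < s → concat t₀ ψ ρ s.toNNReal = ρ (s - t₀).toNNReal := fun s hs => by
    rw [concat, if_neg (not_le.2 (Real.lt_toNNReal_iff_coe_lt.2 hs)), toNNReal_sub_coe]
  have hLint : ∀ t : ℝ≥0, t ≤ t₀ → IntervalIntegrable
      (fun s : ℝ => b (concat t₀ ψ ρ s.toNNReal)) volume 0 t ∧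
      ∫ s in (0 : ℝ)..t, b (concat t₀ ψ ρ s.toNNReal) =
        ∫ s in (0 : ℝ)..t, b (ψ s.toNNReal) := by
    intro t ht
    have ht' : (t : ℝ) ≤ t₀ := by exact_mod_cast ht
    refine ⟨(hψ t).1.congr fun s hs => ?_, intervalIntegral.integral_congr fun s hs => ?_⟩
    · rw [uIoc_of_le t.coe_nonneg] at hs
      simp only [hL s (hs.2.trans ht')]
    · rw [uIcc_of_le t.coe_nonneg] at hs
      simp only [hL s (hs.2.trans ht')]
  intro t
  rcases le_or_gt t t₀ with ht | ht
  · refine ⟨(hLint t ht).1, ?_⟩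
    rw [(hLint t ht).2, concat, if_pos ht, (hψ t).2, hf0 t ht]
  · obtain ⟨s, rfl⟩ := exists_add_of_le ht.le
    have ht' : (t₀ : ℝ) ≤ (t₀ + s : ℝ≥0) := by exact_mod_cast ht.le
    have hi : IntervalIntegrable (fun u : ℝ => b (ρ (u - t₀).toNNReal)) volume t₀ (t₀ + s : ℝ≥0) := by
      have := (hρ s).1.comp_sub_right (t₀ : ℝ)
      simpa [add_comm] using this
    have hcongr : ∀ u ∈ uIoc (t₀ : ℝ) (t₀ + s : ℝ≥0),
        b (ρ (u - t₀).toNNReal) = b (concat t₀ ψ ρ u.toNNReal) := by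
      intro u hu
      rw [uIoc_of_le ht'] at hu
      rw [hR u hu.1]
    have hi2 := hi.congr hcongr
    refine ⟨(hLint t₀ le_rfl).1.trans hi2, ?_⟩
    rw [← intervalIntegral.integral_add_adjacent_intervals (hLint t₀ le_rfl).1 hi2,
      (hLint t₀ le_rfl).2, ← intervalIntegral.integral_congr_ae (Eventually.of_forall hcongr),
      intervalIntegral.integral_comp_sub_right (fun u : ℝ => b (ρ u.toNNReal)),
      concat, if_neg (not_le.2 ht), hf1]
    have h1 := (hψ t₀).2
    have h2 := (hρ s).2
    simp only [sub_self, NNReal.coe_add, add_sub_cancel_left, sub_zero] at *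
    rw [add_tsub_cancel_left, h2, ← hy, h1]; ring

theorem hittingTime_concat (hψ : ∀ t ≤ t₀, c < ψ t) (h0 : ρ 0 = ψ t₀) :
    hittingTime c (concat t₀ ψ ρ) = t₀ + hittingTime c ρ := by
  apply le_antisymm
  · rw [← tsub_le_iff_left]
    refine le_iInf₂ fun s hs => ?_
    rw [tsub_le_iff_left]
    -- At time `t₀` the concatenated path takes its value from `ψ`, hence above `c`.
    have hs0 : s ≠ 0 := by
      rintro rfl
      rw [h0] at hs
      exact absurd (hψ t₀ le_rfl) (not_lt.2 hs)
    have h1 : t₀ < t₀ + s := lt_add_of_pos_right _ (pos_iff_ne_zero.2 hs0)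
    have : concat t₀ ψ ρ (t₀ + s) ≤ c := by
      rw [concat, if_neg (not_le.2 h1), add_tsub_cancel_left]; exact hs
    exact (hittingTime_le this).trans (by simp)
  · refine le_iInf₂ fun t ht => ?_
    rcases le_or_gt t t₀ with h | h
    · rw [concat, if_pos h] at ht
      exact absurd (hψ t h) (not_lt.2 ht)
    · rw [concat, if_neg (not_le.2 h)] at ht
      calc (t₀ : ℝ≥0∞) + hittingTime c ρ ≤ t₀ + ((t - t₀ : ℝ≥0) : ℝ≥0∞) := by
            gcongr; exact hittingTime_le ht
        _ = t := by rw [← ENNReal.coe_add, add_tsub_cancel_of_le h.le]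

/-- Discarding the contribution of `(0, t₀]` and translating by `t₀` gives equality for the rest;
the inequality suffices for a lower bound on the value. -/
theorem discountedReturn_delay {δ : ℝ} {l : ℝ≥0 → ℝ} (hl : Monotone l) (t₀ : ℝ≥0) (T : ℝ≥0∞) :
    ENNReal.ofReal (Real.exp (-δ * t₀)) * discountedReturn δ l T ≤
      discountedReturn δ (fun s => l (s - t₀)) (t₀ + T) := by
  unfold discountedReturn
  set G : ℝ → ℝ≥0∞ := fun t => ENNReal.ofReal (δ * Real.exp (-δ * t)) *
    ENNReal.ofReal (paidThrough (fun s => l (s - t₀)) (min (ENNReal.ofReal t) (t₀ + T)).toReal) with hG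
  have h1 : ∫⁻ t in Ioi (t₀ : ℝ), G t ≤ ∫⁻ t in Ioi (0 : ℝ), G t :=
    lintegral_mono_set (Ioi_subset_Ioi t₀.coe_nonneg)
  refine le_trans (le_of_eq ?_) h1
  have h2 : (fun s : ℝ => (Ioi (t₀ : ℝ)).indicator G (s + t₀)) =
      (Ioi (0 : ℝ)).indicator fun s => G (s + t₀) := by
    funext s; simp [indicator]
  have h4 : ∫⁻ t in Ioi (t₀ : ℝ), G t = ∫⁻ s in Ioi (0 : ℝ), G (s + t₀) := by
    rw [← lintegral_indicator measurableSet_Ioi, ← lintegral_indicator measurableSet_Ioi, ← h2,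
      lintegral_add_right_eq_self]
  rw [h4, ← lintegral_const_mul' _ _ ENNReal.ofReal_ne_top]
  refine setLIntegral_congr_fun measurableSet_Ioi fun s hs => ?_
  have hs0 : 0 ≤ s := le_of_lt hs
  have h3 : (min (ENNReal.ofReal (s + t₀)) (t₀ + T)).toReal =
      (min (ENNReal.ofReal s) T).toReal + t₀ := by
    rw [ENNReal.ofReal_add hs0 t₀.coe_nonneg, ENNReal.ofReal_coe_nnreal, add_comm _ (t₀ : ℝ≥0∞),
      min_add_add_left, ENNReal.toReal_add ENNReal.coe_ne_top
        ((min_le_left _ _).trans_lt ENNReal.ofReal_lt_top).ne, ENNReal.coe_toReal, add_comm]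
  simp only [hG]
  rw [h3, paidThrough_delay hl, add_sub_cancel_right, ← mul_assoc,
    ← ENNReal.ofReal_mul (Real.exp_pos _).le]
  congr 2
  rw [mul_add, Real.exp_add]; ring

end Concatenation

/-! ### Left-continuous paths encoded by countably many values -/

section CountablePaths

open TopologicalSpace

/-- The left-continuous path with (increasing) values `a i` at the times of a dense sequence. -/
noncomputable def supPath (a : ℕ → ℝ≥0∞) (t : ℝ≥0) : ℝ :=
  (⨆ i, if denseSeq ℝ≥0 i < t then a i else 0).toReal

/-- The suprema defining `supPath a` are finite. -/
def IsFinitePath (a : ℕ → ℝ≥0∞) : Prop :=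
  ∀ n : ℕ, (⨆ i, if denseSeq ℝ≥0 i < (n : ℝ≥0) then a i else 0) ≠ ∞

variable {a : ℕ → ℝ≥0∞}

theorem monotone_iSup_ite (a : ℕ → ℝ≥0∞) :
    Monotone fun t : ℝ≥0 => ⨆ i, if denseSeq ℝ≥0 i < t then a i else 0 := by
  refine fun s t hst => iSup_mono fun i => ?_
  by_cases h : denseSeq ℝ≥0 i < s
  · simp [h, h.trans_le hst]
  · simp [h]

theorem IsFinitePath.ne_top (ha : IsFinitePath a) (t : ℝ≥0) :
    (⨆ i, if denseSeq ℝ≥0 i < t then a i else 0) ≠ ∞ := by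
  obtain ⟨n, hn⟩ := exists_nat_ge t
  exact ((monotone_iSup_ite a hn).trans_lt (ha n).lt_top).ne

theorem IsFinitePath.monotone_supPath (ha : IsFinitePath a) : Monotone (supPath a) :=
  fun _ t hst => ENNReal.toReal_mono (ha.ne_top t) (monotone_iSup_ite a hst)

theorem supPath_zero (a : ℕ → ℝ≥0∞) : supPath a 0 = 0 := by
  simp [supPath]

theorem IsFinitePath.continuousWithinAt_supPath (ha : IsFinitePath a) (t : ℝ≥0) :
    ContinuousWithinAt (supPath a) (Iic t) t := by
  refine (ENNReal.tendsto_toReal (ha.ne_top t)).comp (tendsto_order.2 ⟨fun b hb => ?_, fun b hb => ?_⟩)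
  · obtain ⟨i, hi⟩ := lt_iSup_iff.1 hb
    by_cases h : denseSeq ℝ≥0 i < t
    · filter_upwards [nhdsWithin_le_nhds (Ioi_mem_nhds h)] with s hs
      refine hi.trans_le ?_
      rw [if_pos h]
      exact (by rw [if_pos (mem_Ioi.1 hs)] : a i = if denseSeq ℝ≥0 i < s then a i else 0).le.trans
        (le_iSup (fun i => if denseSeq ℝ≥0 i < s then a i else 0) i)
    · simp [h] at hi
  · filter_upwards [self_mem_nhdsWithin] with s hs
    exact (monotone_iSup_ite a hs).trans_lt hb

theorem exists_denseSeq_mem_Ioo {s t : ℝ≥0} (h : s < t) :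
    ∃ i, s < denseSeq ℝ≥0 i ∧ denseSeq ℝ≥0 i < t := by
  exact (denseRange_denseSeq ℝ≥0).exists_mem_open isOpen_Ioo (nonempty_Ioo.2 h)

/-- A nondecreasing left-continuous path is recovered from its values at the dense times strictly
before `t`. A whole strategy is thus described by countably many random variables, each known at its
own time. -/
theorem iSup_ite_ofReal {l : ℝ≥0 → ℝ} (hl : Monotone l) (h0 : l 0 = 0)
    (hc : ∀ t, ContinuousWithinAt l (Iic t) t) (t : ℝ≥0) :
    (⨆ i, if denseSeq ℝ≥0 i < t then ENNReal.ofReal (l (denseSeq ℝ≥0 i)) else 0) =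
      ENNReal.ofReal (l t) := by
  apply le_antisymm
  · refine iSup_le fun i => ?_
    split_ifs with h
    · exact ENNReal.ofReal_le_ofReal (hl h.le)
    · exact zero_le
  · rcases eq_or_ne t 0 with rfl | ht0
    · simp [h0]
    have : (𝓝[<] t).NeBot := nhdsLT_neBot_of_exists_lt ⟨0, pos_iff_ne_zero.2 ht0⟩
    refine le_of_tendsto (ENNReal.tendsto_ofReal
      ((hc t).mono_left (nhdsWithin_mono _ Iio_subset_Iic_self))) ?_
    filter_upwards [self_mem_nhdsWithin] with s hs
    obtain ⟨i, h1, h2⟩ := exists_denseSeq_mem_Ioo (mem_Iio.1 hs)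
    refine (ENNReal.ofReal_le_ofReal (hl h1.le)).trans (le_trans (le_of_eq ?_)
      (le_iSup (fun i => if denseSeq ℝ≥0 i < t then ENNReal.ofReal (l (denseSeq ℝ≥0 i)) else 0) i))
    simp [h2]

theorem isFinitePath_ofReal {l : ℝ≥0 → ℝ} (hl : Monotone l) (h0 : l 0 = 0)
    (hc : ∀ t, ContinuousWithinAt l (Iic t) t) :
    IsFinitePath fun i => ENNReal.ofReal (l (denseSeq ℝ≥0 i)) := fun n => by
  rw [iSup_ite_ofReal hl h0 hc]; exact ENNReal.ofReal_ne_top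

theorem supPath_ofReal {l : ℝ≥0 → ℝ} (hl : Monotone l) (h0 : l 0 = 0)
    (hc : ∀ t, ContinuousWithinAt l (Iic t) t) :
    supPath (fun i => ENNReal.ofReal (l (denseSeq ℝ≥0 i))) = l := by
  funext t
  rw [supPath, iSup_ite_ofReal hl h0 hc, ENNReal.toReal_ofReal (h0 ▸ hl (zero_le (a := t)))]

/-- If `ρ` cannot leave `(-∞, c]`, its hitting time is determined by a dense set of times. -/
theorem hittingTime_eq_iInf {c : ℝ} {ρ : ℝ≥0 → ℝ} (h : ∀ s t, s ≤ t → ρ s ≤ c → ρ t ≤ c) :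
    hittingTime c ρ = ⨅ i, if ρ (denseSeq ℝ≥0 i) ≤ c then (denseSeq ℝ≥0 i : ℝ≥0∞) else ∞ := by
  apply le_antisymm
  · refine le_iInf fun i => ?_
    split_ifs with hi
    · exact hittingTime_le hi
    · exact le_top
  · refine le_iInf₂ fun t ht => ?_
    refine le_of_forall_gt fun u hu => ?_
    obtain ⟨v, htv, hvu⟩ := ENNReal.lt_iff_exists_nnreal_btwn.1 hu
    obtain ⟨i, h1, h2⟩ := exists_denseSeq_mem_Ioo (show t < v by exact_mod_cast htv)
    refine (iInf_le _ i).trans_lt ?_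
    rw [if_pos (h t _ h1.le ht)]
    exact lt_trans (by exact_mod_cast h2) hvu

variable {E : Type*} [MeasurableSpace E]

theorem measurable_iSup_ite {β : Type*} [MeasurableSpace β] {τ : β → ℝ≥0} (hτ : Measurable τ)
    {a : ℕ → β → ℝ≥0∞} (ha : ∀ i, Measurable (a i)) :
    Measurable fun e => ⨆ i, if denseSeq ℝ≥0 i < τ e then a i e else 0 :=
  Measurable.iSup fun i => Measurable.ite (measurableSet_lt measurable_const hτ) (ha i)
    measurable_const

theorem measurable_supPath {a : ℕ → E → ℝ≥0∞} (ha : ∀ i, Measurable (a i)) :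
    Measurable (Function.uncurry fun t e => supPath (fun i => a i e) t) :=
  (measurable_iSup_ite measurable_fst fun i => (ha i).comp measurable_snd).ennreal_toReal

theorem measurableSet_isFinitePath {a : ℕ → E → ℝ≥0∞} (ha : ∀ i, Measurable (a i)) :
    MeasurableSet {e | IsFinitePath fun i => a i e} := by
  have : {e | IsFinitePath fun i => a i e} = ⋂ n : ℕ,
      {e | (⨆ i, if denseSeq ℝ≥0 i < (n : ℝ≥0) then a i e else 0) = ∞}ᶜ := by
    ext e; simp [IsFinitePath]
  rw [this]
  exact MeasurableSet.iInter fun n =>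
    (measurable_iSup_ite measurable_const ha (measurableSet_singleton ∞)).compl

theorem measurable_paidThrough {l : ℝ≥0 → E → ℝ} (hl : Measurable (Function.uncurry l))
    (hm : ∀ e, Monotone fun t => l t e) :
    Measurable (Function.uncurry fun (t : ℝ) e => paidThrough (fun s => l s e) t) := by
  have hu : Tendsto (fun n : ℕ => 1 / ((n : ℝ) + 1)) atTop (𝓝 0) := tendsto_one_div_add_atTop_nhds_zero_nat
  refine measurable_of_tendsto_metrizable (f := fun (n : ℕ) (q : ℝ × E) =>
    l (q.1 + 1 / ((n : ℝ) + 1)).toNNReal q.2) (fun n => hl.comp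
      ((measurable_real_toNNReal.comp (measurable_fst.add_const _)).prodMk measurable_snd)) ?_
  rw [tendsto_pi_nhds]
  rintro ⟨t, e⟩
  refine (tendsto_paidThrough (hm e) t).comp (tendsto_nhdsWithin_iff.2 ⟨?_, ?_⟩)
  · simpa using hu.const_add t
  · refine Eventually.of_forall fun n => ?_
    have : (0 : ℝ) < 1 / ((n : ℝ) + 1) := by positivity
    simp only [mem_Ioi]; linarith

theorem measurable_discountedReturn (δ : ℝ) {l : ℝ≥0 → E → ℝ} (hl : Measurable (Function.uncurry l))
    (hm : ∀ e, Monotone fun t => l t e) {T : E → ℝ≥0∞} (hT : Measurable T) :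
    Measurable fun e => discountedReturn δ (fun t => l t e) (T e) := by
  refine Measurable.lintegral_prod_right' (f := fun q : E × ℝ =>
    ENNReal.ofReal (δ * Real.exp (-δ * q.2)) *
    ENNReal.ofReal (paidThrough (fun s => l s q.1) (min (ENNReal.ofReal q.2) (T q.1)).toReal)) ?_
  refine Measurable.mul (by fun_prop) (ENNReal.measurable_ofReal.comp ?_)
  exact (measurable_paidThrough hl hm).comp (Measurable.prodMk
    ((measurable_snd.ennreal_ofReal.min (hT.comp measurable_fst)).ennreal_toReal) measurable_fst)

end CountablePaths

/-! ### Estimates for the drift -/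

section Drift

variable {p r α : ℝ}

theorem drift_eq_of_nonneg {u : ℝ} (hu : 0 ≤ u) : drift p r α u = p + r * u := by
  simp [drift, hu]

theorem drift_eq_of_nonpos {u : ℝ} (hu : u ≤ 0) : drift p r α u = p + α * u := by
  rcases hu.lt_or_eq with h | rfl
  · simp [drift, not_le.2 h]
  · simp [drift]

theorem monotone_drift (hr : 0 < r) (hrα : r < α) : Monotone (drift p r α) := by
  intro u v huv
  rcases le_total 0 u with hu | hu
  · rw [drift_eq_of_nonneg hu, drift_eq_of_nonneg (hu.trans huv)]
    nlinarith
  · rcases le_total 0 v with hv | hv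
    · rw [drift_eq_of_nonneg hv, drift_eq_of_nonpos hu]
      nlinarith
    · rw [drift_eq_of_nonpos hv, drift_eq_of_nonpos hu]
      nlinarith

theorem drift_sub_le (hrα : r < α) {u v : ℝ} (huv : u ≤ v) :
    drift p r α v - drift p r α u ≤ α * (v - u) := by
  rcases le_total 0 u with hu | hu
  · rw [drift_eq_of_nonneg hu, drift_eq_of_nonneg (hu.trans huv)]
    nlinarith
  · rcases le_total 0 v with hv | hv
    · rw [drift_eq_of_nonneg hv, drift_eq_of_nonpos hu]
      nlinarith
    · rw [drift_eq_of_nonpos hv, drift_eq_of_nonpos hu]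
      nlinarith

theorem abs_drift_sub_le (hr : 0 < r) (hrα : r < α) (u v : ℝ) :
    |drift p r α u - drift p r α v| ≤ α * |u - v| := by
  rcases le_total u v with h | h
  · rw [abs_sub_comm, abs_sub_comm u, abs_of_nonneg (sub_nonneg.2 (monotone_drift hr hrα h)),
      abs_of_nonneg (sub_nonneg.2 h)]
    exact drift_sub_le hrα h
  · rw [abs_of_nonneg (sub_nonneg.2 (monotone_drift hr hrα h)), abs_of_nonneg (sub_nonneg.2 h)]
    exact drift_sub_le hrα h

theorem drift_critical (hp : 0 < p) (hr : 0 < r) (hrα : r < α) : drift p r α (-(p / α)) = 0 := by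
  have hα : 0 < α := hr.trans hrα
  rw [drift_eq_of_nonpos (by have := div_pos hp hα; linarith)]
  field_simp; simp

/-- One of two linear majorants in the form `A + K * (u - c)` of `paidThrough_le`: here `A = 0`, so
the payments vanish with the initial excess, at the price of the growth rate `α`. -/
theorem drift_le_of_ge (hp : 0 < p) (hr : 0 < r) (hrα : r < α) {u : ℝ} (hu : -(p / α) ≤ u) :
    drift p r α u ≤ 0 + α * (u - -(p / α)) := by
  have := drift_sub_le (p := p) hrα hu
  rw [drift_critical hp hr hrα] at this
  linarith

/-- The other majorant: growth rate `r < δ`, which discounting beats, but with `A = p`. -/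
theorem drift_le_linear (hp : 0 < p) (hr : 0 < r) (hrα : r < α) (u : ℝ) :
    drift p r α u ≤ p + r * (u - -(p / α)) := by
  have hα : 0 < α := hr.trans hrα
  have := div_pos hp hα
  rcases le_total 0 u with h | h
  · rw [drift_eq_of_nonneg h]; nlinarith
  · rw [drift_eq_of_nonpos h]; nlinarith

/-- The hypothesis of `IsReservePath.le_of_le`: the critical level is absorbing. -/
theorem drift_le_posPart (hp : 0 < p) (hr : 0 < r) (hrα : r < α) (u : ℝ) :
    drift p r α u ≤ α * max (u - -(p / α)) 0 := by
  rcases le_total (-(p / α)) u with h | h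
  · rw [max_eq_left (by linarith)]
    linarith [drift_le_of_ge hp hr hrα h]
  · rw [max_eq_right (by linarith), mul_zero, ← drift_critical hp hr hrα]
    exact monotone_drift hr hrα h

theorem drift_pos (hp : 0 < p) (hr : 0 < r) (hrα : r < α) {u : ℝ} (hu : -(p / α) < u) :
    0 < drift p r α u := by
  have hα : 0 < α := hr.trans hrα
  rcases le_total 0 u with h | h
  · rw [drift_eq_of_nonneg h]; positivity
  · rw [drift_eq_of_nonpos h]
    have := mul_lt_mul_of_pos_left hu hα
    have e : α * -(p / α) = -p := by field_simp
    linarith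

/-- From `x > -p/α` the undisturbed reserve increases and reaches `y ≥ x` by time
`(y - x) / drift x`. -/
theorem exists_isReservePath_zero (hp : 0 < p) (hr : 0 < r) (hrα : r < α) {x y : ℝ}
    (hx : -(p / α) < x) (hxy : x ≤ y) :
    ∃ (ψ : ℝ≥0 → ℝ) (t₀ : ℝ≥0), IsReservePath (drift p r α) x (fun _ => 0) ψ ∧ (∀ t, x ≤ ψ t) ∧
      ψ t₀ = y ∧ t₀ * drift p r α x ≤ y - x := by
  have hα : 0 < α := hr.trans hrα
  have hlip := abs_drift_sub_le (p := p) hr hrα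
  obtain ⟨ρ, -, hρ⟩ := exists_measurable_isReservePath (E := Unit) (f := fun _ _ => 0) hα hlip x
    measurable_const fun _ => monotone_const
  set ψ : ℝ≥0 → ℝ := fun t => ρ t () with hψ
  have h : IsReservePath (drift p r α) x (fun _ => 0) ψ := hρ ()
  have hd := drift_pos hp hr hrα hx
  -- Barrier from below: where `ψ < x`, the Lipschitz bound and `drift x > 0` bound `-drift ψ` by `α
  -- (x - ψ)`, so Gronwall applies to the positive part of `x - ψ`.
  have hge : ∀ t, x ≤ ψ t := by
    intro t
    have hint : ∀ u : ℝ, 0 ≤ u →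
        IntervalIntegrable (fun v : ℝ => max (x - ψ v.toNNReal) 0) volume 0 u := fun u hu => by
      have h1 := (intervalIntegrable_const (c := x)).sub (h.intervalIntegrable monotone_const le_rfl hu)
      exact (intervalIntegrable_iff_integrableOn_Ioc_of_le hu).2
        ((intervalIntegrable_iff_integrableOn_Ioc_of_le hu).1 h1).pos_part
    have := nonpos_of_le_mul_integral_posPart (D := fun u => x - ψ u.toNNReal) hα.le
      (hint t t.coe_nonneg) (fun u hu => ?_) (⟨t.coe_nonneg, le_rfl⟩ : (t : ℝ) ∈ Icc (0 : ℝ) t)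
    · simp only [Real.toNNReal_coe] at this; linarith
    · have e := h.eq_real hu.1
      rw [← intervalIntegral.integral_const_mul]
      have : ∫ v in (0 : ℝ)..u, -drift p r α (ψ v.toNNReal) ≤
          ∫ v in (0 : ℝ)..u, α * max (x - ψ v.toNNReal) 0 := by
        refine intervalIntegral.integral_mono_on hu.1 (h.intervalIntegrable_drift le_rfl hu.1).neg
          ((hint u hu.1).const_mul α) fun v _ => ?_
        rcases le_total (ψ v.toNNReal) x with hv | hv
        · rw [max_eq_left (by linarith)]
          have := drift_sub_le (p := p) hrα hv
          linarith
        · rw [max_eq_right (by linarith)]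
          have := monotone_drift (p := p) hr hrα hv
          linarith
      rw [intervalIntegral.integral_neg] at this
      linarith
  have hgrow : ∀ t : ℝ≥0, x + t * drift p r α x ≤ ψ t := by
    intro t
    have h1 : ∫ s in (0 : ℝ)..t, drift p r α x ≤ ∫ s in (0 : ℝ)..t, drift p r α (ψ s.toNNReal) :=
      intervalIntegral.integral_mono_on t.coe_nonneg intervalIntegrable_const (h t).1 fun s _ =>
        monotone_drift hr hrα (hge _)
    rw [intervalIntegral.integral_const, sub_zero, smul_eq_mul] at h1
    rw [(h t).2]; linarith
  -- The time at which the linear lower bound of `hgrow` reaches `y`.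
  set T : ℝ := (y - x) / drift p r α x with hT
  have hT0 : 0 ≤ T := div_nonneg (sub_nonneg.2 hxy) hd.le
  have hcont : ContinuousOn (fun s : ℝ => ψ s.toNNReal) (Icc 0 T) := by
    refine ((continuousOn_const (c := x)).add (h.continuousOn_integral T hT0)).congr fun s hs => ?_
    rw [h.eq_real hs.1, sub_zero]; rfl
  have hψ0 : ψ (0 : ℝ).toNNReal = x := by rw [h.eq_real le_rfl]; simp
  obtain ⟨s, hs, hsy⟩ := intermediate_value_Icc hT0 hcont (show y ∈ Icc _ _ from by
    refine ⟨hψ0.le.trans hxy, ?_⟩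
    have := hgrow T.toNNReal
    rw [Real.coe_toNNReal _ hT0, hT, div_mul_cancel₀ _ hd.ne'] at this
    rw [hT]; linarith)
  refine ⟨ψ, s.toNNReal, h, hge, hsy, ?_⟩
  have := hgrow s.toNNReal
  simp only at hsy
  linarith

end Drift

/-! ### The exponential distribution -/

section Exponential

variable {lam : ℝ}

theorem expMeasure_eq_withDensity (lam : ℝ) :
    expMeasure lam = volume.withDensity (exponentialPDF lam) := rfl

theorem measurable_exponentialPDF (lam : ℝ) : Measurable (exponentialPDF lam) :=
  (measurable_exponentialPDFReal lam).ennreal_ofReal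

/-- The exponential distribution has no memory. -/
theorem lintegral_expMeasure_sub (lam : ℝ) {a : ℝ} (ha : 0 ≤ a) {h : ℝ → ℝ≥0∞} (hh : Measurable h) :
    ∫⁻ w, (Ioi a).indicator (fun w => h (w - a)) w ∂(expMeasure lam) =
      ENNReal.ofReal (Real.exp (-(lam * a))) * ∫⁻ w, h w ∂(expMeasure lam) := by
  have hm : Measurable ((Ioi a).indicator fun w => h (w - a)) :=
    (hh.comp (measurable_id.sub_const a)).indicator measurableSet_Ioi
  rw [expMeasure_eq_withDensity, lintegral_withDensity_eq_lintegral_mul _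
    (measurable_exponentialPDF lam) hm, lintegral_withDensity_eq_lintegral_mul _
    (measurable_exponentialPDF lam) hh, ← lintegral_const_mul' _ _ ENNReal.ofReal_ne_top,
    ← lintegral_add_right_eq_self _ a]
  refine lintegral_congr_ae ?_
  have : ∀ᵐ s : ℝ, s ≠ 0 := by simp [ae_iff, measure_singleton]
  filter_upwards [this] with s hs
  rcases lt_or_gt_of_ne hs with h0 | h0
  · simp [indicator, h0.le, exponentialPDF_of_neg h0]
  · have h1 : s + a ∈ Ioi a := by simp [h0]
    simp only [Pi.mul_apply, indicator_of_mem h1, add_sub_cancel_right]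
    rw [exponentialPDF_of_nonneg h0.le, exponentialPDF_of_nonneg (by positivity), ← mul_assoc,
      ← ENNReal.ofReal_mul (Real.exp_pos _).le]
    congr 2
    rw [mul_add, neg_add, Real.exp_add]; ring

theorem expMeasure_Iic_zero (lam : ℝ) : expMeasure lam (Iic 0) = 0 := by
  rw [expMeasure_eq_withDensity, withDensity_apply _ measurableSet_Iic,
    setLIntegral_congr Iio_ae_eq_Iic.symm]
  exact lintegral_exponentialPDF_of_nonpos le_rfl

theorem expMeasure_Ioi_one_ne_zero (hlam : 0 < lam) : expMeasure lam (Ioi 1) ≠ 0 := by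
  have := isProbabilityMeasure_expMeasure hlam
  have h := lintegral_expMeasure_sub lam zero_le_one (h := fun _ => 1) measurable_const
  have e : ∫⁻ w, (Ioi (1 : ℝ)).indicator (fun _ => (1 : ℝ≥0∞)) w ∂(expMeasure lam) =
      expMeasure lam (Ioi 1) := lintegral_indicator_one measurableSet_Ioi
  rw [e, lintegral_const, measure_univ, mul_one, mul_one] at h
  rw [h]
  simp [Real.exp_pos]

end Exponential

/-! ### The canonical space of claim sequences -/

/-- Sequences of waiting times and of claim sizes. -/
abbrev ClaimSeq : Type := (ℕ → ℝ) × (ℕ → ℝ)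

namespace ClaimSeq

/-- The epoch of the `n`-th claim. -/
def epoch (e : ClaimSeq) (n : ℕ) : ℝ := ∑ i ∈ Finset.range (n + 1), e.1 i

/-- The aggregate claims up to time `t`. -/
noncomputable def total (t : ℝ≥0) (e : ClaimSeq) : ℝ :=
  (∑' n, if epoch e n ≤ t then ENNReal.ofReal (e.2 n) else 0).toReal

/-- Waiting times are positive and have divergent sum, claims are nonnegative. -/
def IsGood (e : ClaimSeq) : Prop :=
  (∀ n, 0 < e.1 n) ∧ (∀ n, 0 ≤ e.2 n) ∧ ∀ m : ℕ, ∃ n, (m : ℝ) < epoch e n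

theorem measurable_epoch (n : ℕ) : Measurable fun e : ClaimSeq => epoch e n :=
  Finset.measurable_sum _ fun i _ => (measurable_pi_apply i).comp measurable_fst

theorem measurable_total : Measurable (Function.uncurry total) := by
  refine (Measurable.tsum fun n => ?_).ennreal_toReal
  exact Measurable.ite
    (measurableSet_le ((measurable_epoch n).comp measurable_snd)
      (measurable_coe_nnreal_real.comp measurable_fst))
    ((measurable_pi_apply n).comp (measurable_snd.comp measurable_snd)).ennreal_ofReal
    measurable_const

theorem measurableSet_isGood : MeasurableSet {e : ClaimSeq | IsGood e} := by
  have : {e : ClaimSeq | IsGood e} = (⋂ n, {e | 0 < e.1 n}) ∩ ((⋂ n, {e | 0 ≤ e.2 n}) ∩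
      ⋂ m : ℕ, ⋃ n, {e | (m : ℝ) < epoch e n}) := by
    ext e; simp [IsGood]
  rw [this]
  refine (MeasurableSet.iInter fun n => ?_).inter ((MeasurableSet.iInter fun n => ?_).inter
    (MeasurableSet.iInter fun m => MeasurableSet.iUnion fun n => ?_))
  · exact measurableSet_lt measurable_const ((measurable_pi_apply n).comp measurable_fst)
  · exact measurableSet_le measurable_const ((measurable_pi_apply n).comp measurable_snd)
  · exact measurableSet_lt measurable_const (measurable_epoch n)

theorem epoch_succ (e : ClaimSeq) (n : ℕ) : epoch e (n + 1) = epoch e n + e.1 (n + 1) :=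
  Finset.sum_range_succ _ _

namespace IsGood

variable {e : ClaimSeq}

theorem strictMono_epoch (he : IsGood e) : StrictMono (epoch e) :=
  strictMono_nat_of_lt_succ fun n => by rw [epoch_succ]; linarith [he.1 (n + 1)]

theorem exists_count (he : IsGood e) (t : ℝ) : ∃ N : ℕ, ∀ n, epoch e n ≤ t ↔ n < N := by
  have hex : ∃ n, t < epoch e n := by
    obtain ⟨m, hm⟩ := exists_nat_ge t
    obtain ⟨n, hn⟩ := he.2.2 m
    exact ⟨n, hm.trans_lt hn⟩
  classical
  refine ⟨Nat.find hex, fun n => ⟨fun h => ?_, fun h => not_lt.1 (Nat.find_min hex h)⟩⟩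
  by_contra! hn
  exact absurd (Nat.find_spec hex) (not_lt.2 ((he.strictMono_epoch.monotone hn).trans h))

/-- The extended nonnegative series in `total` serves joint measurability; on good sequences it is a
finite sum. -/
theorem total_eq (he : IsGood e) {t : ℝ≥0} {N : ℕ} (hN : ∀ n, epoch e n ≤ t ↔ n < N) :
    total t e = ∑ n ∈ Finset.range N, e.2 n := by
  have h1 : ∑' n, (if epoch e n ≤ t then ENNReal.ofReal (e.2 n) else 0) =
      ∑ n ∈ Finset.range N, ENNReal.ofReal (e.2 n) := by
    rw [tsum_eq_sum (s := Finset.range N) fun n hn => if_neg fun h =>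
      hn (Finset.mem_range.2 ((hN n).1 h))]
    exact Finset.sum_congr rfl fun n hn => if_pos ((hN n).2 (Finset.mem_range.1 hn))
  rw [total, h1, ← ENNReal.ofReal_sum_of_nonneg fun n _ => he.2.1 n,
    ENNReal.toReal_ofReal (Finset.sum_nonneg fun n _ => he.2.1 n)]

theorem monotone_total (he : IsGood e) : Monotone fun t => total t e := by
  intro s t hst
  obtain ⟨N, hN⟩ := he.exists_count s
  obtain ⟨N', hN'⟩ := he.exists_count t
  have hst' : (s : ℝ) ≤ t := by exact_mod_cast hst
  have hNN : N ≤ N' := by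
    by_contra! h
    exact lt_irrefl N' ((hN' N').1 (((hN N').2 h).trans hst'))
  simp only [he.total_eq hN, he.total_eq hN']
  exact Finset.sum_le_sum_of_subset_of_nonneg (Finset.range_mono hNN) fun n _ _ => he.2.1 n

theorem total_zero (he : IsGood e) : total 0 e = 0 := by
  rw [he.total_eq (N := 0)]
  · simp
  · intro n
    have : 0 < epoch e n := Finset.sum_pos (fun i _ => he.1 i) ⟨0, by simp⟩
    simp [this]

end IsGood

end ClaimSeq

/-! ### Renewal of the claims at a fixed time -/

namespace ClaimModel

variable {Ω : Type*} [MeasurableSpace Ω] {μ : Measure Ω} {lam : ℝ} {F : Measure ℝ}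
  (M : ClaimModel μ lam F)

theorem measurable_waitingTime (n : ℕ) : Measurable (waitingTime M.S n) := by
  cases n with
  | zero => exact M.measurable_S 0
  | succ n => exact (M.measurable_S (n + 1)).sub (M.measurable_S n)

/-- The waiting times and claims from given indices on. -/
def tail (j k : ℕ) (ω : Ω) : ClaimSeq := (fun n => waitingTime M.S (j + n) ω, fun n => M.U (k + n) ω)

theorem measurable_tail (j k : ℕ) : Measurable (M.tail j k) :=
  (measurable_pi_lambda _ fun _ => M.measurable_waitingTime _).prodMk
    (measurable_pi_lambda _ fun _ => M.measurable_U _)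

theorem epoch_tail (ω : Ω) (n : ℕ) : (M.tail 0 0 ω).epoch n = M.S n ω := by
  induction n with
  | zero => simp [ClaimSeq.epoch, tail, waitingTime]
  | succ n ih =>
    rw [ClaimSeq.epoch_succ, ih]
    simp [tail, waitingTime]

theorem count_eq {ω : Ω} {t : ℝ≥0} {N : ℕ} (hN : ∀ n, M.S n ω ≤ t ↔ n < N) : M.count t ω = N := by
  have : {n : ℕ | M.S n ω ≤ t} = Finset.range N := by ext n; simp [hN]
  rw [count, this, Set.ncard_coe_finset, Finset.card_range]

theorem le_iff_lt_count {ω : Ω} (hω : (M.tail 0 0 ω).IsGood) (t : ℝ≥0) (n : ℕ) :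
    M.S n ω ≤ t ↔ n < M.count t ω := by
  obtain ⟨N, hN⟩ := hω.exists_count t
  simp only [epoch_tail] at hN
  rw [M.count_eq hN, hN]

theorem aggregate_eq_total {ω : Ω} (hω : (M.tail 0 0 ω).IsGood) (t : ℝ≥0) :
    M.aggregate t ω = (M.tail 0 0 ω).total t := by
  rw [hω.total_eq (N := M.count t ω) fun n => by rw [epoch_tail]; exact M.le_iff_lt_count hω t n]
  simp [aggregate, tail]

/-- The claims after time `t₀`, if `k` claims have arrived until then. -/
def shiftIndex (t₀ : ℝ≥0) (k : ℕ) (ω : Ω) : ClaimSeq :=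
  (fun n => if n = 0 then M.S k ω - t₀ else waitingTime M.S (k + n) ω, fun n => M.U (k + n) ω)

/-- The claims after time `t₀`, with time measured from `t₀` on. -/
noncomputable def shift (t₀ : ℝ≥0) (ω : Ω) : ClaimSeq := M.shiftIndex t₀ (M.count t₀ ω) ω

theorem measurable_shiftIndex (t₀ : ℝ≥0) (k : ℕ) : Measurable (M.shiftIndex t₀ k) := by
  refine (measurable_pi_lambda _ fun n => ?_).prodMk (measurable_pi_lambda _ fun n => M.measurable_U _)
  by_cases hn : n = 0
  · simp only [hn, if_true]; exact (M.measurable_S k).sub_const _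
  · simp only [hn, if_false]; exact M.measurable_waitingTime _

theorem measurable_shift (t₀ : ℝ≥0) : Measurable (M.shift t₀) := by
  have h : Measurable fun q : ℕ × Ω => M.shiftIndex t₀ q.1 q.2 :=
    measurable_from_prod_countable_right fun k => M.measurable_shiftIndex t₀ k
  exact h.comp ((M.measurable_count t₀).prodMk measurable_id)

theorem epoch_shiftIndex (t₀ : ℝ≥0) (k : ℕ) (ω : Ω) (n : ℕ) :
    (M.shiftIndex t₀ k ω).epoch n = M.S (k + n) ω - t₀ := by
  induction n with
  | zero => simp [ClaimSeq.epoch, shiftIndex]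
  | succ n ih =>
    rw [ClaimSeq.epoch_succ, ih]
    simp only [shiftIndex, Nat.add_eq_zero_iff, one_ne_zero, and_false, if_false]
    rw [← add_assoc k n 1, waitingTime]; ring

theorem isGood_shift {ω : Ω} (hω : (M.tail 0 0 ω).IsGood) (t₀ : ℝ≥0) : (M.shift t₀ ω).IsGood := by
  refine ⟨fun n => ?_, fun n => ?_, fun m => ?_⟩
  · simp only [shift, shiftIndex]
    split_ifs with hn
    · have := (M.le_iff_lt_count hω t₀ (M.count t₀ ω)).not.2 (lt_irrefl _)
      linarith
    · have := hω.1 (M.count t₀ ω + n)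
      simpa [tail] using this
  · have := hω.2.1 (M.count t₀ ω + n)
    simpa [tail, shift, shiftIndex] using this
  · obtain ⟨m', hm'⟩ := exists_nat_ge ((m : ℝ) + t₀)
    obtain ⟨n, hn⟩ := hω.2.2 m'
    refine ⟨n, ?_⟩
    rw [shift, epoch_shiftIndex]
    rw [epoch_tail] at hn
    have := hω.strictMono_epoch.monotone (Nat.le_add_left n (M.count t₀ ω))
    simp only [epoch_tail] at this
    linarith

theorem total_shift {ω : Ω} (hω : (M.tail 0 0 ω).IsGood) (t₀ s : ℝ≥0) :
    (M.shift t₀ ω).total s = M.aggregate (t₀ + s) ω - M.aggregate t₀ ω := by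
  have hle : M.count t₀ ω ≤ M.count (t₀ + s) ω := by
    by_contra! h
    have h1 := (M.le_iff_lt_count hω t₀ _).2 h
    have h2 : M.S (M.count (t₀ + s) ω) ω ≤ (t₀ + s : ℝ≥0) :=
      h1.trans (by exact_mod_cast le_self_add)
    exact lt_irrefl _ ((M.le_iff_lt_count hω _ _).1 h2)
  obtain ⟨d, hd⟩ := exists_add_of_le hle
  rw [(M.isGood_shift hω t₀).total_eq (N := d) fun n => ?_]
  · rw [aggregate, aggregate, hd, Finset.sum_range_add, add_sub_cancel_left]
    rfl
  · rw [shift, epoch_shiftIndex, sub_le_iff_le_add', ← NNReal.coe_add, M.le_iff_lt_count hω, hd]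
    omega

section Law

/-- The sum of the first `k` waiting times. -/
def elapsed (k : ℕ) (ω : Ω) : ℝ := ∑ i ∈ Finset.range k, waitingTime M.S i ω

theorem measurable_elapsed (k : ℕ) : Measurable (M.elapsed k) :=
  Finset.measurable_sum _ fun i _ => M.measurable_waitingTime i

theorem indepFun_elapsed (j : ℕ) :
    IndepFun (M.elapsed j) (fun ω (n : ℕ) => waitingTime M.S (j + n) ω) μ := by
  have h := indep_iSup_of_disjoint (fun i => (M.measurable_waitingTime i).comap_le) M.indep_wait
    (S := Iio j) (T := Ici j) (disjoint_left.2 fun i h1 h2 => absurd (mem_Iio.1 h1) (not_lt.2 h2))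
  refine indep_of_indep_of_le_left (indep_of_indep_of_le_right h ?_) ?_
  · rw [← measurable_iff_comap_le]
    refine @measurable_pi_lambda _ _ _ (_) _ _ fun n => ?_
    rw [measurable_iff_comap_le]
    exact le_iSup₂_of_le (j + n) (by simp) le_rfl
  · rw [← measurable_iff_comap_le]
    refine @Finset.measurable_sum _ _ _ _ _ _ (_) _ _ fun i hi => ?_
    rw [measurable_iff_comap_le]
    exact le_iSup₂_of_le i (by simpa using hi) le_rfl

theorem S_eq_elapsed_add (k : ℕ) (ω : Ω) : M.S k ω = M.elapsed k ω + waitingTime M.S k ω := by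
  rw [← M.epoch_tail, ClaimSeq.epoch, Finset.sum_range_succ]
  simp [elapsed, tail]

theorem elapsed_count_le {ω : Ω} (hω : (M.tail 0 0 ω).IsGood) (t₀ : ℝ≥0) :
    M.elapsed (M.count t₀ ω) ω ≤ t₀ ∧ t₀ < M.S (M.count t₀ ω) ω := by
  refine ⟨?_, not_le.1 fun h => lt_irrefl _ ((M.le_iff_lt_count hω t₀ _).1 h)⟩
  rcases hk : M.count t₀ ω with _ | k
  · simp [elapsed]
  · have := (M.le_iff_lt_count hω t₀ k).2 (by omega)
    rw [← epoch_tail] at this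
    simpa [elapsed, ClaimSeq.epoch, tail] using this

variable [IsProbabilityMeasure μ]

theorem map_tail (j k : ℕ) : μ.map (M.tail j k) =
    (Measure.infinitePi fun _ : ℕ => expMeasure lam).prod (Measure.infinitePi fun _ : ℕ => F) := by
  have hW : Measurable fun ω (n : ℕ) => waitingTime M.S (j + n) ω :=
    measurable_pi_lambda _ fun n => M.measurable_waitingTime _
  have hU : Measurable fun ω (n : ℕ) => M.U (k + n) ω := measurable_pi_lambda _ fun n => M.measurable_U _
  have hind : IndepFun (fun ω (n : ℕ) => waitingTime M.S (j + n) ω) (fun ω (n : ℕ) => M.U (k + n) ω) μ :=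
    M.indep_wait_U.comp (φ := fun (w : ℕ → ℝ) n => w (j + n)) (ψ := fun (w : ℕ → ℝ) n => w (k + n))
      (measurable_pi_lambda _ fun n => measurable_pi_apply _)
      (measurable_pi_lambda _ fun n => measurable_pi_apply _)
  have h1 := (indepFun_iff_map_prod_eq_prod_map_map hW.aemeasurable hU.aemeasurable).1 hind
  have h2 := (M.indep_wait.precomp (g := fun n => j + n)
    (add_right_injective j)).map_fun_eq_infinitePi_map fun n => M.measurable_waitingTime _
  have h3 := (M.indep_U.precomp (g := fun n => k + n)
    (add_right_injective k)).map_fun_eq_infinitePi_map fun n => M.measurable_U _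
  simp only [M.law_wait] at h2
  simp only [M.law_U] at h3
  rw [← h2, ← h3, ← h1]
  rfl

theorem map_tail_eq (j k : ℕ) : μ.map (M.tail j k) = μ.map (M.tail 0 0) := by
  rw [map_tail, map_tail]

/-- Renewal at the `j`-th claim: what follows is independent of the time elapsed and has the
original law. The two sides use disjoint blocks of waiting times, and the claim sizes are
independent of all of them. -/
theorem map_elapsed_tail (j k : ℕ) : μ.map (fun ω => (M.elapsed j ω, M.tail j k ω)) =
    (μ.map (M.elapsed j)).prod (μ.map (M.tail 0 0)) := by
  have hX := M.measurable_elapsed j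
  have hW : Measurable fun ω (n : ℕ) => waitingTime M.S (j + n) ω :=
    measurable_pi_lambda _ fun n => M.measurable_waitingTime _
  have hU : Measurable fun ω (n : ℕ) => M.U (k + n) ω := measurable_pi_lambda _ fun n => M.measurable_U _
  have h1 := (indepFun_iff_map_prod_eq_prod_map_map hX.aemeasurable hW.aemeasurable).1
    (M.indepFun_elapsed j)
  have hind : IndepFun (fun ω => (M.elapsed j ω, fun n : ℕ => waitingTime M.S (j + n) ω))
      (fun ω (n : ℕ) => M.U (k + n) ω) μ :=
    M.indep_wait_U.comp
      (φ := fun w : ℕ → ℝ => (∑ i ∈ Finset.range j, w i, fun n : ℕ => w (j + n)))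
      (ψ := fun (w : ℕ → ℝ) n => w (k + n))
      ((Finset.measurable_sum _ fun i _ => measurable_pi_apply i).prodMk
        (measurable_pi_lambda _ fun n => measurable_pi_apply _))
      (measurable_pi_lambda _ fun n => measurable_pi_apply _)
  have h2 := (indepFun_iff_map_prod_eq_prod_map_map (hX.prodMk hW).aemeasurable
    hU.aemeasurable).1 hind
  have hind' : IndepFun (fun ω (n : ℕ) => waitingTime M.S (j + n) ω)
      (fun ω (n : ℕ) => M.U (k + n) ω) μ := hind.comp measurable_snd measurable_id
  have h3 := (indepFun_iff_map_prod_eq_prod_map_map hW.aemeasurable hU.aemeasurable).1 hind'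
  have := Measure.isProbabilityMeasure_map (μ := μ) hX.aemeasurable
  have := Measure.isProbabilityMeasure_map (μ := μ) hW.aemeasurable
  have := Measure.isProbabilityMeasure_map (μ := μ) hU.aemeasurable
  have h4 : μ.map (fun ω => (M.elapsed j ω, M.tail j k ω)) =
      (μ.map fun ω => ((M.elapsed j ω, fun n : ℕ => waitingTime M.S (j + n) ω),
        fun n : ℕ => M.U (k + n) ω)).map MeasurableEquiv.prodAssoc := by
    rw [Measure.map_map MeasurableEquiv.prodAssoc.measurable ((hX.prodMk hW).prodMk hU)]
    rfl
  rw [h4, h2, h1, Measure.prodAssoc_prod, ← h3, ← M.map_tail_eq j k]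
  rfl

/-- Subtract `a` from the first waiting time. -/
def delay (a : ℝ) (e : ClaimSeq) : ClaimSeq := (fun n => if n = 0 then e.1 0 - a else e.1 n, e.2)

theorem measurable_delay : Measurable fun q : ℝ × ClaimSeq => delay q.1 q.2 := by
  refine (measurable_pi_lambda _ fun n => ?_).prodMk (measurable_snd.comp measurable_snd)
  by_cases hn : n = 0
  · simp only [hn, if_true]
    exact ((measurable_pi_apply 0).comp (measurable_fst.comp measurable_snd)).sub measurable_fst
  · simp only [hn, if_false]
    exact (measurable_pi_apply n).comp (measurable_fst.comp measurable_snd)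

/-- Prepend a waiting time. -/
def cons (q : ℝ × ClaimSeq) : ClaimSeq := (fun n => if n = 0 then q.1 else q.2.1 (n - 1), q.2.2)

theorem measurable_cons : Measurable cons := by
  refine (measurable_pi_lambda _ fun n => ?_).prodMk (measurable_snd.comp measurable_snd)
  by_cases hn : n = 0
  · simp only [hn, if_true]; exact measurable_fst
  · simp only [hn, if_false]
    exact (measurable_pi_apply _).comp (measurable_fst.comp measurable_snd)

theorem map_cons : ((expMeasure lam).prod (μ.map (M.tail 0 0))).map cons = μ.map (M.tail 0 0) := by
  have h := M.map_elapsed_tail 1 0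
  have e : M.elapsed 1 = waitingTime M.S 0 := by funext ω; simp [elapsed]
  rw [e, M.law_wait] at h
  rw [← h, Measure.map_map measurable_cons ((M.measurable_waitingTime 0).prodMk (M.measurable_tail 1 0))]
  congr 1
  funext ω
  refine Prod.ext (funext fun n => ?_) rfl
  simp only [Function.comp, cons, tail]
  split_ifs with hn
  · rw [hn]
  · rw [zero_add, show 1 + (n - 1) = n by omega]

/-- Lifts the lack of memory from one waiting time to the whole sequence: by `map_cons` the first
waiting time can be integrated out separately. -/
theorem lintegral_delay {a : ℝ} (ha : 0 ≤ a) {g : ClaimSeq → ℝ≥0∞} (hg : Measurable g) :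
    ∫⁻ e, {e : ClaimSeq | a < e.1 0}.indicator (fun e => g (delay a e)) e ∂(μ.map (M.tail 0 0)) =
      ENNReal.ofReal (Real.exp (-(lam * a))) * ∫⁻ e, g e ∂(μ.map (M.tail 0 0)) := by
  have := Measure.isProbabilityMeasure_map (μ := μ) (M.measurable_tail 0 0).aemeasurable
  have : IsProbabilityMeasure (expMeasure lam) := by
    rw [← M.law_wait 0]
    exact Measure.isProbabilityMeasure_map (M.measurable_waitingTime 0).aemeasurable
  have hs : MeasurableSet {e : ClaimSeq | a < e.1 0} :=
    measurableSet_lt measurable_const ((measurable_pi_apply 0).comp measurable_fst)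
  have hd : Measurable fun e => g (delay a e) :=
    hg.comp (measurable_delay.comp (measurable_const.prodMk measurable_id))
  have hgc : Measurable fun q => g (cons q) := hg.comp measurable_cons
  conv_lhs => rw [← M.map_cons]
  conv_rhs => rw [← M.map_cons]
  have hc := (hd.indicator hs).comp measurable_cons
  simp only [Function.comp_def] at hc
  rw [lintegral_map (hd.indicator hs) measurable_cons, lintegral_map hg measurable_cons,
    lintegral_prod_symm' _ hc, lintegral_prod_symm' _ hgc,
    ← lintegral_const_mul' _ _ ENNReal.ofReal_ne_top]
  refine lintegral_congr fun e => ?_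
  rw [← lintegral_expMeasure_sub lam ha (h := fun w => g (cons (w, e)))
    (hgc.comp (measurable_id.prodMk measurable_const))]
  refine lintegral_congr fun w => ?_
  by_cases hw : a < w
  · have h1 : cons (w, e) ∈ {e : ClaimSeq | a < e.1 0} := by simpa [cons] using hw
    rw [indicator_of_mem h1, indicator_of_mem (mem_Ioi.2 hw)]
    congr 1
    refine Prod.ext (funext fun n => ?_) rfl
    simp only [delay, cons]
    split_ifs <;> rfl
  · have h1 : cons (w, e) ∉ {e : ClaimSeq | a < e.1 0} := by simpa [cons] using hw
    rw [indicator_of_notMem h1, indicator_of_notMem (by simpa using hw)]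

/-- When exactly `k` claims have arrived by `t₀`, the current waiting time has already lasted `t₀ -
elapsed k`. Given this duration, `lintegral_delay` restores the original law, so the integral
factorizes. -/
theorem lintegral_shiftIndex (t₀ : ℝ≥0) (k : ℕ) {g : ClaimSeq → ℝ≥0∞} (hg : Measurable g) :
    ∫⁻ ω in {ω | M.elapsed k ω ≤ t₀ ∧ t₀ < M.S k ω}, g (M.shiftIndex t₀ k ω) ∂μ =
      (∫⁻ x in Iic (t₀ : ℝ), ENNReal.ofReal (Real.exp (-(lam * (t₀ - x)))) ∂(μ.map (M.elapsed k))) *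
        ∫⁻ ω, g (M.tail 0 0 ω) ∂μ := by
  have := Measure.isProbabilityMeasure_map (μ := μ) (M.measurable_tail 0 0).aemeasurable
  have := Measure.isProbabilityMeasure_map (μ := μ) (M.measurable_elapsed k).aemeasurable
  set H : ℝ × ClaimSeq → ℝ≥0∞ := {q : ℝ × ClaimSeq | q.1 ≤ t₀ ∧ t₀ - q.1 < q.2.1 0}.indicator
    fun q => g (delay (t₀ - q.1) q.2) with hH
  have hHm : Measurable H := by
    refine Measurable.indicator ?_ ?_
    · exact hg.comp (measurable_delay.comp ((measurable_const.sub measurable_fst).prodMk measurable_snd))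
    · exact (measurableSet_le measurable_fst measurable_const).inter
        (measurableSet_lt (measurable_const.sub measurable_fst)
          ((measurable_pi_apply 0).comp (measurable_fst.comp measurable_snd)))
  have hD : MeasurableSet {ω | M.elapsed k ω ≤ t₀ ∧ t₀ < M.S k ω} :=
    (measurableSet_le (M.measurable_elapsed k) measurable_const).inter
      (measurableSet_lt measurable_const (M.measurable_S k))
  have h1 : ∀ ω, {ω | M.elapsed k ω ≤ t₀ ∧ t₀ < M.S k ω}.indicator
      (fun ω => g (M.shiftIndex t₀ k ω)) ω = H (M.elapsed k ω, M.tail k k ω) := by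
    intro ω
    have hiff : ω ∈ {ω | M.elapsed k ω ≤ t₀ ∧ t₀ < M.S k ω} ↔ (M.elapsed k ω, M.tail k k ω) ∈
        {q : ℝ × ClaimSeq | q.1 ≤ t₀ ∧ t₀ - q.1 < q.2.1 0} := by
      simp only [mem_ofPred_eq, tail, add_zero, M.S_eq_elapsed_add k ω, sub_lt_iff_lt_add']
    by_cases hω : ω ∈ {ω | M.elapsed k ω ≤ t₀ ∧ t₀ < M.S k ω}
    · rw [indicator_of_mem hω, hH, indicator_of_mem (hiff.1 hω)]
      congr 1
      refine Prod.ext (funext fun n => ?_) rfl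
      simp only [shiftIndex, delay, tail, add_zero]
      split_ifs
      · rw [M.S_eq_elapsed_add]; ring
      · rfl
    · rw [indicator_of_notMem hω, hH, indicator_of_notMem (hiff.not.1 hω)]
  rw [← lintegral_indicator hD, lintegral_congr h1,
    ← lintegral_map hHm ((M.measurable_elapsed k).prodMk (M.measurable_tail k k)),
    M.map_elapsed_tail, lintegral_prod _ hHm.aemeasurable,
    ← lintegral_map hg (M.measurable_tail 0 0), ← lintegral_mul_const _ (by fun_prop),
    ← lintegral_indicator measurableSet_Iic]
  refine lintegral_congr fun x => ?_
  by_cases hx : x ≤ t₀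
  · rw [indicator_of_mem (mem_Iic.2 hx), ← M.lintegral_delay (sub_nonneg.2 hx) hg]
    refine lintegral_congr fun e => ?_
    simp [hH, indicator, hx]
  · rw [indicator_of_notMem (by simpa using hx)]
    simp [hH, hx]

/-- The epochs diverge because, by the second Borel–Cantelli lemma, infinitely many of the
independent waiting times exceed `1`. -/
theorem ae_isGood (hlam : 0 < lam) (hF : F (Iio 0) = 0) : ∀ᵐ ω ∂μ, (M.tail 0 0 ω).IsGood := by
  have h1 : ∀ᵐ ω ∂μ, ∀ n, 0 < waitingTime M.S n ω := ae_all_iff.2 fun n => by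
    rw [ae_iff]
    have := expMeasure_Iic_zero lam
    rw [← M.law_wait n, Measure.map_apply (M.measurable_waitingTime n) measurableSet_Iic] at this
    simpa [preimage] using this
  have h2 : ∀ᵐ ω ∂μ, ∀ n, 0 ≤ M.U n ω := ae_all_iff.2 fun n => by
    rw [ae_iff]
    rw [← M.law_U n, Measure.map_apply (M.measurable_U n) measurableSet_Iio] at hF
    simpa [preimage] using hF
  have h3 : ∀ᵐ ω ∂μ, ∃ᶠ n in atTop, 1 < waitingTime M.S n ω := by
    have hm : ∀ n, MeasurableSet (waitingTime M.S n ⁻¹' Ioi 1) := fun n =>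
      M.measurable_waitingTime n measurableSet_Ioi
    have hind : iIndepSet (fun n => waitingTime M.S n ⁻¹' Ioi 1) μ := by
      rw [iIndepSet_iff_meas_biInter hm]
      exact fun s => M.indep_wait.measure_inter_preimage_eq_mul _ fun _ _ => measurableSet_Ioi
    have hsum : ∑' n, μ (waitingTime M.S n ⁻¹' Ioi 1) = ∞ := by
      have : ∀ n, μ (waitingTime M.S n ⁻¹' Ioi 1) = expMeasure lam (Ioi 1) := fun n => by
        rw [← M.law_wait n, Measure.map_apply (M.measurable_waitingTime n) measurableSet_Ioi]
      simp only [this]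
      exact ENNReal.tsum_const_eq_top_of_ne_zero (expMeasure_Ioi_one_ne_zero hlam)
    have h := measure_limsup_eq_one hm hind hsum
    have hmem : ∀ᵐ ω ∂μ, ω ∈ limsup (fun n => waitingTime M.S n ⁻¹' Ioi 1) atTop :=
      (mem_ae_iff_prob_eq_one (MeasurableSet.measurableSet_limsup hm)).2 h
    filter_upwards [hmem] with ω hω
    rw [mem_limsup_iff_frequently_mem] at hω
    exact hω
  filter_upwards [h1, h2, h3] with ω hω1 hω2 hω3
  refine ⟨fun n => by simpa [tail] using hω1 n, fun n => by simpa [tail] using hω2 n, fun m => ?_⟩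
  have hmono : StrictMono ((M.tail 0 0 ω).epoch) := strictMono_nat_of_lt_succ fun n => by
    rw [ClaimSeq.epoch_succ]
    have := hω1 (n + 1)
    simpa [tail] using this
  induction m with
  | zero => exact ⟨0, by simpa [ClaimSeq.epoch, tail] using hω1 0⟩
  | succ m ih =>
    obtain ⟨n, hn⟩ := ih
    obtain ⟨k, hnk, hk⟩ := (frequently_atTop.1 hω3) (n + 1)
    obtain ⟨j, rfl⟩ := exists_add_of_le hnk
    refine ⟨n + 1 + j, ?_⟩
    rw [show n + 1 + j = n + j + 1 by ring] at hk ⊢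
    rw [ClaimSeq.epoch_succ]
    have h4 := hmono.monotone (Nat.le_add_right n j)
    have h5 : (M.tail 0 0 ω).1 (n + j + 1) = waitingTime M.S (n + j + 1) ω := by simp [tail]
    rw [h5]
    push_cast
    linarith

/-- Almost sure properties of the claims are inherited by the claims after time `t₀`. -/
theorem ae_shift_mem (hgood : ∀ᵐ ω ∂μ, (M.tail 0 0 ω).IsGood) (t₀ : ℝ≥0) {G : Set ClaimSeq}
    (hG : MeasurableSet G) (h : ∀ᵐ ω ∂μ, M.tail 0 0 ω ∈ G) : ∀ᵐ ω ∂μ, M.shift t₀ ω ∈ G := by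
  have hk : ∀ᵐ ω ∂μ, ∀ k, M.elapsed k ω ≤ t₀ ∧ t₀ < M.S k ω → M.shiftIndex t₀ k ω ∈ G := by
    -- Apply the factorization to the indicator of the complement of `G`: its second factor is zero.
    refine ae_all_iff.2 fun k => ?_
    have h1 := M.lintegral_shiftIndex t₀ k (measurable_one.indicator hG.compl)
    have h2 : ∫⁻ ω, Gᶜ.indicator 1 (M.tail 0 0 ω) ∂μ = 0 := by
      refine lintegral_eq_zero_of_ae_eq_zero ?_
      filter_upwards [h] with ω hω
      simp [hω]
    have hm : Measurable fun ω => (Gᶜ.indicator 1 (M.shiftIndex t₀ k ω) : ℝ≥0∞) :=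
      (measurable_one.indicator hG.compl).comp (M.measurable_shiftIndex t₀ k)
    rw [h2, mul_zero, lintegral_eq_zero_iff hm] at h1
    have hD : MeasurableSet {ω | M.elapsed k ω ≤ t₀ ∧ t₀ < M.S k ω} :=
      (measurableSet_le (M.measurable_elapsed k) measurable_const).inter
        (measurableSet_lt measurable_const (M.measurable_S k))
    filter_upwards [(ae_restrict_iff' hD).1 h1] with ω hω hω'
    by_contra hn
    have := hω hω'
    simp [hn] at this
  filter_upwards [hk, hgood] with ω h1 h2
  exact h1 _ (M.elapsed_count_le h2 t₀)

/-- With probability at least `exp (-lam * t₀)` the claims start afresh at `t₀`. -/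
theorem mul_lintegral_tail_le (hgood : ∀ᵐ ω ∂μ, (M.tail 0 0 ω).IsGood) (t₀ : ℝ≥0)
    {g : ClaimSeq → ℝ≥0∞} (hg : Measurable g) :
    ENNReal.ofReal (Real.exp (-(lam * t₀))) * ∫⁻ ω, g (M.tail 0 0 ω) ∂μ ≤
      ∫⁻ ω in {ω | M.aggregate t₀ ω = 0}, g (M.shift t₀ ω) ∂μ := by
  have h := M.lintegral_shiftIndex t₀ 0 hg
  -- For `k = 0` the elapsed time is `0`, so the first factor is `exp (-lam * t₀)`. The event that
  -- no claim has arrived lies, up to a null set, in `{Y_{t₀} = 0}`; the latter is larger when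
  -- claims may have size zero, but it is the one that the filtration sees.
  have e : M.elapsed 0 = fun _ => 0 := by funext ω; simp [elapsed]
  rw [e, Measure.map_const, measure_univ, one_smul, restrict_dirac' measurableSet_Iic,
    if_pos (mem_Iic.2 t₀.coe_nonneg), lintegral_dirac, sub_zero] at h
  rw [← h]
  have hae : ∀ᵐ ω ∂μ, t₀ < M.S 0 ω → M.count t₀ ω = 0 := by
    filter_upwards [hgood] with ω hω h0
    by_contra hn
    exact absurd ((M.le_iff_lt_count hω t₀ 0).2 (Nat.pos_of_ne_zero hn)) (not_le.2 h0)
  have hD : MeasurableSet {ω | (0 : ℝ) ≤ t₀ ∧ t₀ < M.S 0 ω} :=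
    MeasurableSet.inter (MeasurableSet.const _) (measurableSet_lt measurable_const (M.measurable_S 0))
  have hA : MeasurableSet {ω | M.aggregate t₀ ω = 0} :=
    M.measurable_aggregate t₀ (measurableSet_singleton 0)
  rw [← lintegral_indicator hD, ← lintegral_indicator hA]
  refine lintegral_mono_ae ?_
  filter_upwards [hae] with ω hω
  by_cases h0 : (t₀ : ℝ) < M.S 0 ω
  · have hc := hω h0
    have h1 : ω ∈ {ω | M.aggregate t₀ ω = 0} := by simp [aggregate, hc]
    have h2 : ω ∈ {ω | (0 : ℝ) ≤ t₀ ∧ t₀ < M.S 0 ω} := ⟨t₀.coe_nonneg, h0⟩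
    rw [indicator_of_mem h1, indicator_of_mem h2, shift, hc]
  · rw [indicator_of_notMem fun h => h0 h.2]
    exact zero_le

end Law

end ClaimModel

/-! ### Information: the filtration and the history of the claim sequence -/

open TopologicalSpace (denseSeq)

/-- The information in the aggregate claims up to time `t`. -/
@[reducible]
noncomputable def ClaimSeq.history (t : ℝ≥0) : MeasurableSpace ClaimSeq :=
  ⨆ s : Iic t, MeasurableSpace.comap (ClaimSeq.total s) inferInstance

theorem ClaimSeq.measurable_total_apply (t : ℝ≥0) : Measurable (ClaimSeq.total t) :=
  ClaimSeq.measurable_total.comp (measurable_const.prodMk measurable_id)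

theorem ClaimSeq.history_le (t : ℝ≥0) :
    ClaimSeq.history t ≤ (inferInstance : MeasurableSpace ClaimSeq) :=
  iSup_le fun s => (ClaimSeq.measurable_total_apply s).comap_le

section

variable {Ω : Type*} [MeasurableSpace Ω] {μ : Measure Ω} {lam : ℝ} {F : Measure ℝ}
  (M : ClaimModel μ lam F)

namespace ClaimModel

theorem measurableSet_filtration_of_measure_eq_zero (t : ℝ≥0) {A : Set Ω} (hA : MeasurableSet A)
    (h0 : μ A = 0) : MeasurableSet[M.filtration t] A :=
  (le_sup_right : _ ≤ M.filtration t) _ (MeasurableSpace.measurableSet_generateFrom ⟨hA, h0⟩)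

theorem measurableSet_filtration_of_ae_eq (t : ℝ≥0) {A B : Set Ω} (hA : MeasurableSet A)
    (hB : MeasurableSet[M.filtration t] B) (h : A =ᵐ[μ] B) : MeasurableSet[M.filtration t] A := by
  have hB' := (M.filtration.le t) _ hB
  have e : A = (B ∪ A \ B) \ (B \ A) := by
    ext ω; simp only [Set.mem_sdiff, mem_union]; tauto
  rw [e]
  exact (hB.union (M.measurableSet_filtration_of_measure_eq_zero t (hA.diff hB')
    (ae_le_set.1 h.le))).diff
    (M.measurableSet_filtration_of_measure_eq_zero t (hB'.diff hA) (ae_le_set.1 h.symm.le))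

theorem measurable_filtration_of_ae_eq {β : Type*} [MeasurableSpace β] (t : ℝ≥0) {f g : Ω → β}
    (hf : Measurable f) (hg : Measurable[M.filtration t] g) (h : f =ᵐ[μ] g) :
    Measurable[M.filtration t] f := fun s hs => by
  refine M.measurableSet_filtration_of_ae_eq t (hf hs) (hg hs) ?_
  filter_upwards [h] with ω hω
  exact propext (by simp only [mem_preimage, hω] : ω ∈ f ⁻¹' s ↔ ω ∈ g ⁻¹' s)

theorem measurable_filtration_aggregate {s t : ℝ≥0} (hst : s ≤ t) :
    Measurable[M.filtration t] (M.aggregate s) := by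
  rw [measurable_iff_comap_le]
  exact le_sup_of_le_left (le_iSup (fun u : Iic t =>
    MeasurableSpace.comap (M.aggregate u) inferInstance) ⟨s, hst⟩)

theorem filtration_le_eventuallyMeasurableSpace
    (hgood : ∀ᵐ ω ∂μ, (M.tail 0 0 ω).IsGood) (t : ℝ≥0) :
    M.filtration t ≤ eventuallyMeasurableSpace
      (MeasurableSpace.comap (M.tail 0 0) (ClaimSeq.history t)) (ae μ) := by
  refine sup_le (iSup_le fun s => ?_) (MeasurableSpace.generateFrom_le ?_)
  · rintro _ ⟨B, hB, rfl⟩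
    refine ⟨M.tail 0 0 ⁻¹' (ClaimSeq.total s ⁻¹' B), ⟨_, ?_, rfl⟩, ?_⟩
    · exact (le_iSup (fun u : Iic t => MeasurableSpace.comap (ClaimSeq.total u) inferInstance) s) _
        ⟨B, hB, rfl⟩
    · filter_upwards [hgood] with ω hω
      exact propext (by simp only [mem_preimage, M.aggregate_eq_total hω] :
        ω ∈ M.aggregate s ⁻¹' B ↔ ω ∈ M.tail 0 0 ⁻¹' (ClaimSeq.total s ⁻¹' B))
  · rintro A ⟨-, hA⟩
    exact ⟨∅, @MeasurableSet.empty _ (_), ae_eq_empty.2 hA⟩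

/-- A random variable known at time `t` is almost surely a function of the claim history. -/
theorem exists_measurable_history (hgood : ∀ᵐ ω ∂μ, (M.tail 0 0 ω).IsGood) (t : ℝ≥0)
    {f : Ω → ℝ≥0∞} (hf : Measurable[M.filtration t] f) :
    ∃ g : ClaimSeq → ℝ≥0∞, Measurable[ClaimSeq.history t] g ∧ ∀ᵐ ω ∂μ, f ω = g (M.tail 0 0 ω) := by
  have hle := M.filtration_le_eventuallyMeasurableSpace hgood t
  have hf' := hf.mono hle le_rfl
  -- Up to null sets the filtration is pulled back from the history, so indicators factor; sums and
  -- monotone limits preserve factorization.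
  refine @Measurable.ennreal_induction _ (eventuallyMeasurableSpace
    (MeasurableSpace.comap (M.tail 0 0) (ClaimSeq.history t)) (ae μ)) (fun f =>
      ∃ g : ClaimSeq → ℝ≥0∞, Measurable[ClaimSeq.history t] g ∧
        ∀ᵐ ω ∂μ, f ω = g (M.tail 0 0 ω)) ?_ ?_ ?_ f hf'
  · rintro c s ⟨_, ⟨B, hB, rfl⟩, hsB⟩
    refine ⟨B.indicator fun _ => c, (@measurable_const _ _ _ (ClaimSeq.history t) c).indicator hB, ?_⟩
    filter_upwards [hsB] with ω hω
    have : ω ∈ s ↔ M.tail 0 0 ω ∈ B := iff_of_eq hω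
    by_cases h : ω ∈ s
    · rw [indicator_of_mem h, indicator_of_mem (this.1 h)]
    · rw [indicator_of_notMem h, indicator_of_notMem (this.not.1 h)]
  · rintro f g - - - ⟨f', hf', hff'⟩ ⟨g', hg', hgg'⟩
    refine ⟨f' + g', hf'.add hg', ?_⟩
    filter_upwards [hff', hgg'] with ω h1 h2
    simp [h1, h2]
  · intro f _ _ h
    choose g hg hfg using h
    refine ⟨fun e => ⨆ n, g n e, Measurable.iSup hg, ?_⟩
    filter_upwards [ae_all_iff.2 hfg] with ω hω
    simp [hω]

/-- The totals of the shifted claims are almost surely the increments `Y_{t₀+u} - Y_{t₀}`, known at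
`t₀ + s` for `u ≤ s`. This makes a restarted strategy nonanticipating. -/
theorem measurable_filtration_comp_shift (hgood : ∀ᵐ ω ∂μ, (M.tail 0 0 ω).IsGood) (t₀ s : ℝ≥0)
    {g : ClaimSeq → ℝ≥0∞} (hg : Measurable[ClaimSeq.history s] g) :
    Measurable[M.filtration (t₀ + s)] fun ω => g (M.shift t₀ ω) := by
  have : @Measurable _ _ (M.filtration (t₀ + s)) (ClaimSeq.history s) (M.shift t₀) := by
    rw [measurable_iff_comap_le, ClaimSeq.history, MeasurableSpace.comap_iSup]
    refine iSup_le fun u => ?_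
    rw [MeasurableSpace.comap_comp, ← measurable_iff_comap_le]
    have hm : Measurable[M.filtration (t₀ + s)]
        fun ω => M.aggregate (t₀ + u) ω - M.aggregate t₀ ω :=
      (M.measurable_filtration_aggregate (add_le_add_right u.2 t₀)).sub
        (M.measurable_filtration_aggregate le_self_add)
    refine M.measurable_filtration_of_ae_eq _
      ((ClaimSeq.measurable_total_apply u).comp (M.measurable_shift t₀)) hm ?_
    filter_upwards [hgood] with ω hω
    exact M.total_shift hω t₀ u
  exact hg.comp this

end ClaimModel

/-! ### Strategies as functionals of the claim sequence -/

theorem expectedReturn_eq {p α δ : ℝ} (hδ : 0 < δ) (L : DividendProcess M.filtration)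
    (R : ℝ≥0 → Ω → ℝ) : expectedReturn M p α δ L R =
      ∫⁻ ω, discountedReturn δ (fun t => L.paid t ω) (hittingTime (-(p / α)) fun t => R t ω) ∂μ :=
  lintegral_congr fun ω =>
    lintegral_stieltjes_eq_discountedReturn hδ (L.monotone_paid ω) (L.paid_zero ω) _

theorem isReserve_iff {p r α x : ℝ} {L : DividendProcess M.filtration} {R : ℝ≥0 → Ω → ℝ} :
    IsReserve M p r α x L R ↔ ∀ᵐ ω ∂μ, IsReservePath (drift p r α) x
      (fun t => M.aggregate t ω + L.paid t ω) fun t => R t ω := by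
  simp only [IsReserve, IsReservePath, sub_sub]

theorem isAdmissible_iff {p r α x : ℝ} {L : DividendProcess M.filtration} {R : ℝ≥0 → Ω → ℝ} :
    IsAdmissible M p r α x L R ↔ ∀ᵐ ω ∂μ, IsReservePath (drift p r α) x
      (fun t => M.aggregate t ω + L.paid t ω) (fun t => R t ω) ∧
      IsAdmissiblePath (-(p / α)) (fun t => L.paid t ω) fun t => R t ω := by
  rw [IsAdmissible, isReserve_iff, eventually_and]
  simp only [IsAdmissiblePath, sub_neg_eq_add]
  rfl

/-- An admissible strategy is a measurable functional of the sequences of waiting times and claims. -/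
theorem exists_claimSeq_strategy {p r α δ y : ℝ} (hp : 0 < p) (hr : 0 < r) (hrα : r < α) (hδ : 0 < δ)
    (hgood : ∀ᵐ ω ∂μ, (M.tail 0 0 ω).IsGood) {L : DividendProcess M.filtration}
    {R : ℝ≥0 → Ω → ℝ} (hLR : IsAdmissible M p r α y L R) :
    ∃ (l : ℕ → ClaimSeq → ℝ≥0∞) (G : Set ClaimSeq) (g : ClaimSeq → ℝ≥0∞),
      (∀ i, Measurable[ClaimSeq.history (denseSeq ℝ≥0 i)] (l i)) ∧ MeasurableSet G ∧
      (∀ᵐ ω ∂μ, M.tail 0 0 ω ∈ G) ∧ Measurable g ∧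
      ∫⁻ ω, g (M.tail 0 0 ω) ∂μ = expectedReturn M p α δ L R ∧
      ∀ e ∈ G, e.IsGood ∧ IsFinitePath (fun i => l i e) ∧ ∃ ρ : ℝ≥0 → ℝ,
        IsReservePath (drift p r α) y (fun t => e.total t + supPath (fun i => l i e) t) ρ ∧
        IsAdmissiblePath (-(p / α)) (supPath fun i => l i e) ρ ∧
        g e = discountedReturn δ (supPath fun i => l i e) (hittingTime (-(p / α)) ρ) := by
  classical
  set c : ℝ := -(p / α) with hc
  have hα : 0 < α := hr.trans hrα
  have hL : ∀ i, Measurable[M.filtration (denseSeq ℝ≥0 i)]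
      fun ω => ENNReal.ofReal (L.paid (denseSeq ℝ≥0 i) ω) := fun i =>
    ENNReal.measurable_ofReal.comp (L.predictable_paid.stronglyAdapted _).measurable
  choose l hl hlL using fun i => M.exists_measurable_history hgood _ (hL i)
  have hlm : ∀ i, Measurable (l i) := fun i => (hl i).mono (ClaimSeq.history_le _) le_rfl
  set G₀ : Set ClaimSeq := {e | e.IsGood} ∩ {e | IsFinitePath fun i => l i e} with hG₀
  have hG₀m : MeasurableSet G₀ := ClaimSeq.measurableSet_isGood.inter (measurableSet_isFinitePath hlm)
  set Y : ℝ≥0 → ClaimSeq → ℝ := fun t e => if e ∈ G₀ then e.total t else 0 with hY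
  set D : ℝ≥0 → ClaimSeq → ℝ := fun t e => if e ∈ G₀ then supPath (fun i => l i e) t else 0 with hD
  have hYm : Measurable (Function.uncurry Y) :=
    Measurable.ite (measurable_snd hG₀m) ClaimSeq.measurable_total measurable_const
  have hDm : Measurable (Function.uncurry D) :=
    Measurable.ite (measurable_snd hG₀m) (measurable_supPath hlm) measurable_const
  have hYmono : ∀ e, Monotone fun t => Y t e := fun e => by
    by_cases he : e ∈ G₀
    · simpa only [hY, if_pos he] using he.1.monotone_total
    · simpa only [hY, if_neg he] using monotone_const
  have hDmono : ∀ e, Monotone fun t => D t e := fun e => by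
    by_cases he : e ∈ G₀
    · simpa only [hD, if_pos he] using IsFinitePath.monotone_supPath he.2
    · simpa only [hD, if_neg he] using monotone_const
  obtain ⟨ρ, hρm, hρ⟩ := exists_measurable_isReservePath hα (abs_drift_sub_le (p := p) hr hrα) y
    (f := fun t e => Y t e + D t e) (hYm.add hDm) fun e => (hYmono e).add (hDmono e)
  -- An infimum over the dense times is measurable; it is the hitting time because the critical
  -- level is absorbing.
  set τ : ClaimSeq → ℝ≥0∞ := fun e =>
    ⨅ i, if ρ (denseSeq ℝ≥0 i) e ≤ c then (denseSeq ℝ≥0 i : ℝ≥0∞) else ∞ with hτ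
  have hτm : Measurable τ := Measurable.iInf fun i =>
    Measurable.ite (measurableSet_le (hρm.comp (measurable_const.prodMk measurable_id))
      measurable_const) measurable_const measurable_const
  have hτeq : ∀ e, hittingTime c (fun t => ρ t e) = τ e := fun e =>
    hittingTime_eq_iInf fun s t hst hs => (hρ e).le_of_le hα.le (drift_le_posPart hp hr hrα)
      ((hYmono e).add (hDmono e)) hst hs
  -- Before `τ` admissibility is automatic by `paidThrough_sub_le_of_lt_hittingTime`. Only the
  -- condition at the single time `τ` has to be imposed, which keeps `G` measurable.
  set G : Set ClaimSeq := G₀ ∩ {e | τ e = ∞ ∨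
    paidThrough (fun t => D t e) (τ e).toNNReal - D (τ e).toNNReal e ≤
      max (ρ (τ e).toNNReal e - c) 0} with hG
  have hτn : Measurable fun e => ((τ e).toNNReal, e) := hτm.ennreal_toNNReal.prodMk measurable_id
  have hGm : MeasurableSet G := by
    have hle : MeasurableSet {e | paidThrough (fun t => D t e) (τ e).toNNReal -
        D (τ e).toNNReal e ≤ max (ρ (τ e).toNNReal e - c) 0} := by
      refine measurableSet_le ?_ (((hρm.comp hτn).sub_const c).max measurable_const)
      exact ((measurable_paidThrough hDm hDmono).comp
        ((measurable_coe_nnreal_real.comp hτm.ennreal_toNNReal).prodMk measurable_id)).sub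
        (hDm.comp hτn)
    exact hG₀m.inter ((hτm (measurableSet_singleton ∞)).union hle)
  have hmain : ∀ᵐ ω ∂μ, M.tail 0 0 ω ∈ G₀ ∧ (fun t => D t (M.tail 0 0 ω)) = (fun t => L.paid t ω) ∧
      (fun t => ρ t (M.tail 0 0 ω)) = (fun t => R t ω) ∧
      IsAdmissiblePath c (fun t => L.paid t ω) fun t => R t ω := by
    filter_upwards [hgood, ae_all_iff.2 hlL, (isAdmissible_iff M).1 hLR] with ω h1 h2 h3
    have e1 : (fun i => l i (M.tail 0 0 ω)) =
        fun i => ENNReal.ofReal ((fun t => L.paid t ω) (denseSeq ℝ≥0 i)) := by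
      funext i; exact (h2 i).symm
    have hfin : IsFinitePath fun i => l i (M.tail 0 0 ω) := by
      rw [e1]
      exact isFinitePath_ofReal (L.monotone_paid ω) (L.paid_zero ω) (L.leftCts_paid ω)
    have hmem : M.tail 0 0 ω ∈ G₀ := ⟨h1, hfin⟩
    have e2 : (fun t => D t (M.tail 0 0 ω)) = fun t => L.paid t ω := by
      simp only [hD, if_pos hmem]
      rw [e1]
      exact supPath_ofReal (L.monotone_paid ω) (L.paid_zero ω) (L.leftCts_paid ω)
    refine ⟨hmem, e2, ?_, h3.2⟩
    have h4 := hρ (M.tail 0 0 ω)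
    have e3 : (fun t => Y t (M.tail 0 0 ω) + D t (M.tail 0 0 ω)) =
        fun t => M.aggregate t ω + L.paid t ω := by
      funext t
      rw [congrFun e2 t, M.aggregate_eq_total h1]
      simp only [hY, if_pos hmem]
    rw [e3] at h4
    exact h4.unique hα.le (abs_drift_sub_le (p := p) hr hrα) h3.1
  refine ⟨l, G, fun e => discountedReturn δ (fun t => D t e) (τ e), hl, hGm, ?_,
    measurable_discountedReturn δ hDm hDmono hτm, ?_, fun e he => ?_⟩
  · filter_upwards [hmain] with ω ⟨h1, h2, h3, h4⟩
    refine ⟨h1, or_iff_not_imp_left.2 fun htop => ?_⟩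
    have h5 := hτeq (M.tail 0 0 ω)
    rw [h3] at h5
    have h6 := h4 (τ (M.tail 0 0 ω)).toNNReal (by rw [h5, ENNReal.coe_toNNReal htop])
    have h7 := congrFun h2 (τ (M.tail 0 0 ω)).toNNReal
    have h8 := congrFun h3 (τ (M.tail 0 0 ω)).toNNReal
    rw [h2, h7, h8]
    exact h6
  · rw [expectedReturn_eq M hδ]
    refine lintegral_congr_ae ?_
    filter_upwards [hmain] with ω ⟨h1, h2, h3, h4⟩
    rw [← h2, ← h3, hτeq]
  · have hDe : (fun t => D t e) = supPath fun i => l i e := by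
      funext t; simp only [hD, if_pos he.1]
    have hYe : (fun t => Y t e) = fun t => e.total t := by
      funext t; simp only [hY, if_pos he.1]
    have hρe := hρ e
    refine ⟨he.1.1, he.1.2, fun t => ρ t e, ?_, fun t ht => ?_, ?_⟩
    · have e3 : (fun t => Y t e + D t e) = fun t => e.total t + supPath (fun i => l i e) t := by
        funext t; rw [congrFun hDe t, congrFun hYe t]
      rw [← e3]; exact hρe
    · rw [← hDe]
      rcases ht.lt_or_eq with h | h
      · exact (paidThrough_sub_le_of_lt_hittingTime (hYmono e) (hDmono e) hρe h).trans
          (le_max_left _ _)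
      · rw [hτeq] at h
        rcases he.2 with h' | h'
        · rw [← h] at h'
          exact absurd h' ENNReal.coe_ne_top
        · rw [← h] at h'
          simpa using h'
    · change discountedReturn δ (fun t => D t e) (τ e) = _
      rw [hτeq, hDe]

end

/-! ### Delayed strategies and the cost of waiting -/

theorem measurable_predictable_indicator {Ω : Type*} {m : MeasurableSpace Ω} {β : Type*} [MeasurableSpace β]
    [Zero β] (ℱ : Filtration ℝ≥0 m) (s : ℝ≥0) {f : Ω → β} (hf : Measurable[ℱ s] f) :
    Measurable[ℱ.predictable] ((Ioi s ×ˢ (univ : Set Ω)).indicator fun q => f q.2) := by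
  intro B hB
  have h1 : MeasurableSet[ℱ.predictable] (Ioi s ×ˢ (univ : Set Ω)) :=
    measurableSet_predictable_Ioi_prod (MeasurableSet.univ)
  have h2 : MeasurableSet[ℱ.predictable] (Ioi s ×ˢ (f ⁻¹' B)) :=
    measurableSet_predictable_Ioi_prod (hf hB)
  by_cases h0 : (0 : β) ∈ B
  · have : (Ioi s ×ˢ (univ : Set Ω)).indicator (fun q => f q.2) ⁻¹' B =
        (Ioi s ×ˢ (f ⁻¹' B)) ∪ (Ioi s ×ˢ (univ : Set Ω))ᶜ := by
      ext ⟨t, ω⟩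
      by_cases ht : s < t <;> simp [indicator, ht, h0]
    rw [this]
    exact h2.union h1.compl
  · have : (Ioi s ×ˢ (univ : Set Ω)).indicator (fun q => f q.2) ⁻¹' B = Ioi s ×ˢ (f ⁻¹' B) := by
      ext ⟨t, ω⟩
      by_cases ht : s < t <;> simp [indicator, ht, h0]
    rw [this]
    exact h2

section

variable {Ω : Type*} [MeasurableSpace Ω] {μ : Measure Ω} {lam : ℝ} {F : Measure ℝ}
  (M : ClaimModel μ lam F)

/-- On the event `B`, pay according to the path `supPath (a · ω)` delayed by `t₀`. -/
noncomputable def delayedDividends {m : MeasurableSpace Ω} (ℱ : Filtration ℝ≥0 m) (t₀ : ℝ≥0)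
    (B : Set Ω) [DecidablePred (· ∈ B)] (a : ℕ → Ω → ℝ≥0∞) (hB : MeasurableSet[ℱ t₀] B)
    (ha : ∀ i, Measurable[ℱ (t₀ + denseSeq ℝ≥0 i)] (a i))
    (hfin : ∀ ω ∈ B, IsFinitePath fun i => a i ω) : DividendProcess ℱ where
  paid t ω := if ω ∈ B then supPath (fun i => a i ω) (t - t₀) else 0
  paid_zero ω := by simp [supPath_zero]
  monotone_paid ω := by
    by_cases hω : ω ∈ B
    · simp only [hω, if_true]
      exact fun s t hst => (hfin ω hω).monotone_supPath (tsub_le_tsub_right hst _)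
    · simp only [hω, if_false]; exact monotone_const
  leftCts_paid ω t := by
    by_cases hω : ω ∈ B
    · simp only [hω, if_true]
      exact ((hfin ω hω).continuousWithinAt_supPath (t - t₀)).comp
        (f := fun s : ℝ≥0 => s - t₀) (continuous_id.sub continuous_const).continuousWithinAt
        fun s hs => mem_Iic.2 (tsub_le_tsub_right (mem_Iic.1 hs) _)
    · simp only [hω, if_false]; exact continuousWithinAt_const
  predictable_paid := by
    -- The delayed path is a countable supremum of processes switched on strictly after the time at
    -- which their value is known.
    have hm : ∀ i, Measurable[ℱ.predictable] ((Ioi (t₀ + denseSeq ℝ≥0 i) ×ˢ (univ : Set Ω)).indicator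
        fun q => B.indicator (a i) q.2) := fun i =>
      measurable_predictable_indicator ℱ _ ((ha i).indicator (ℱ.mono le_self_add _ hB))
    have he : Function.uncurry (fun t ω => if ω ∈ B then supPath (fun i => a i ω) (t - t₀) else 0) =
        fun q : ℝ≥0 × Ω => (⨆ i, (Ioi (t₀ + denseSeq ℝ≥0 i) ×ˢ (univ : Set Ω)).indicator
          (fun q => B.indicator (a i) q.2) q).toReal := by
      funext ⟨t, ω⟩
      by_cases hω : ω ∈ B
      · simp only [Function.uncurry, hω, if_true, supPath, indicator, lt_tsub_iff_left, mem_prod,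
          mem_Ioi, mem_univ, and_true]
      · simp [Function.uncurry, indicator, hω]
    refine Measurable.stronglyMeasurable ?_
    rw [he]
    exact (Measurable.iSup hm).ennreal_toReal

variable {p r α δ x y : ℝ}

theorem paidThrough_zero (t : ℝ) : paidThrough (fun _ => 0) t = 0 :=
  paidThrough_eq_of_tendsto tendsto_const_nhds

theorem isAdmissiblePath_zero (c : ℝ) (ρ : ℝ≥0 → ℝ) : IsAdmissiblePath c (fun _ => 0) ρ :=
  fun t _ => by rw [paidThrough_zero, sub_zero]; exact le_max_right _ _

theorem exists_isReservePath (hr : 0 < r) (hrα : r < α) (x : ℝ) {f : ℝ≥0 → ℝ} (hf : Monotone f) :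
    ∃ ρ, IsReservePath (drift p r α) x f ρ := by
  obtain ⟨ρ, -, h⟩ := exists_measurable_isReservePath (E := Unit) (f := fun t _ => f t)
    (hr.trans hrα) (abs_drift_sub_le (p := p) hr hrα) x (hf.measurable.comp measurable_fst)
    fun _ => hf
  exact ⟨_, h ()⟩

theorem isAdmissiblePath_concat {c : ℝ} {l ρ ψ : ℝ≥0 → ℝ} {t₀ : ℝ≥0} (hl : Monotone l)
    (hl0 : l 0 = 0) (h : IsAdmissiblePath c l ρ) (hψ : ∀ t ≤ t₀, c < ψ t) (h0 : ρ 0 = ψ t₀) :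
    IsAdmissiblePath c (fun t => l (t - t₀)) (concat t₀ ψ ρ) := by
  intro t ht
  have hl' : Monotone fun t => l (t - t₀) := fun s t hst => hl (tsub_le_tsub_right hst _)
  rcases lt_or_ge t t₀ with htt | htt
  · have h1 := paidThrough_le_of_lt hl' htt
    simp only [tsub_self, hl0] at h1
    beta_reduce
    rw [tsub_eq_zero_of_le htt.le, hl0, sub_zero]
    exact h1.trans (le_max_right _ _)
  · obtain ⟨s, rfl⟩ := exists_add_of_le htt
    rw [hittingTime_concat hψ h0, ENNReal.coe_add, ENNReal.add_le_add_iff_left ENNReal.coe_ne_top] at ht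
    beta_reduce
    rw [paidThrough_delay hl, NNReal.coe_add, add_sub_cancel_left, add_tsub_cancel_left]
    have e : concat t₀ ψ ρ (t₀ + s) = ρ s := by
      rcases eq_or_ne s 0 with rfl | hs
      · rw [add_zero, concat, if_pos le_rfl, h0]
      · rw [concat, if_neg (not_le.2 (lt_add_of_pos_right _ (pos_iff_ne_zero.2 hs))),
          add_tsub_cancel_left]
    rw [e]
    exact h s ht

/-- Waiting until the reserve has grown from `x` to `y` costs at most the probability of a claim
and the discounting in the meantime. -/
theorem exp_mul_expectedReturn_le_value [IsProbabilityMeasure μ] (hp : 0 < p) (hr : 0 < r)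
    (hrα : r < α) (hδ : 0 < δ) (hgood : ∀ᵐ ω ∂μ, (M.tail 0 0 ω).IsGood) (hx : -(p / α) < x)
    {ψ : ℝ≥0 → ℝ} {t₀ : ℝ≥0} (hψ : IsReservePath (drift p r α) x (fun _ => 0) ψ)
    (hψx : ∀ t, x ≤ ψ t) (hψy : ψ t₀ = y) {L : DividendProcess M.filtration} {R : ℝ≥0 → Ω → ℝ}
    (hLR : IsAdmissible M p r α y L R) :
    ENNReal.ofReal (Real.exp (-((lam + δ) * t₀))) * expectedReturn M p α δ L R ≤
      value M p r α δ x := by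
  classical
  obtain ⟨l, G, g, hl, hG, hGae, hg, hgint, hstrat⟩ :=
    exists_claimSeq_strategy M hp hr hrα hδ hgood hLR
  set A : Set Ω := {ω | M.aggregate t₀ ω = 0} with hA
  set B : Set Ω := A ∩ M.shift t₀ ⁻¹' G with hB
  have hGsh := M.ae_shift_mem hgood t₀ hG hGae
  have hAm : MeasurableSet[M.filtration t₀] A :=
    M.measurable_filtration_aggregate le_rfl (measurableSet_singleton 0)
  -- This event concerns the future after `t₀`, but it has full measure and so belongs to the
  -- augmented filtration.
  have hSm : MeasurableSet[M.filtration t₀] (M.shift t₀ ⁻¹' G) := by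
    refine M.measurableSet_filtration_of_ae_eq t₀ (M.measurable_shift t₀ hG)
      (@MeasurableSet.univ _ (_)) ?_
    filter_upwards [hGsh] with ω hω
    exact propext (iff_of_true hω trivial)
  have hBm : MeasurableSet[M.filtration t₀] B := hAm.inter hSm
  set L' : DividendProcess M.filtration := delayedDividends M.filtration t₀ B
    (fun i ω => l i (M.shift t₀ ω)) hBm
    (fun i => M.measurable_filtration_comp_shift hgood t₀ _ (hl i))
    (fun ω hω => (hstrat _ hω.2).2.1) with hL'
  -- On `B` the reserve follows `ψ` up to `t₀` and then the reserve of the restarted strategy; off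
  -- `B` nothing is ever paid.
  have hpath : ∀ ω, ∃ σ : ℝ≥0 → ℝ, (M.tail 0 0 ω).IsGood →
      IsReservePath (drift p r α) x (fun t => M.aggregate t ω + L'.paid t ω) σ ∧
      IsAdmissiblePath (-(p / α)) (fun t => L'.paid t ω) σ ∧
      (ω ∈ B → ENNReal.ofReal (Real.exp (-δ * t₀)) * g (M.shift t₀ ω) ≤
        discountedReturn δ (fun t => L'.paid t ω) (hittingTime (-(p / α)) σ)) := by
    intro ω
    by_cases hgd : (M.tail 0 0 ω).IsGood
    swap
    · exact ⟨fun _ => 0, fun h => absurd h hgd⟩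
    have hagg : (fun t => M.aggregate t ω) = fun t => (M.tail 0 0 ω).total t := by
      funext t; exact M.aggregate_eq_total hgd t
    have haggm : Monotone fun t => M.aggregate t ω := by rw [hagg]; exact hgd.monotone_total
    by_cases hω : ω ∈ B
    · obtain ⟨h1, h2, ρ, h3, h4, h5⟩ := hstrat _ hω.2
      set d := supPath fun i => l i (M.shift t₀ ω) with hd
      have hpaid : (fun t => L'.paid t ω) = fun t => d (t - t₀) := by
        funext t; exact if_pos hω
      have hd0 : d 0 = 0 := supPath_zero _
      have hdm : Monotone d := h2.monotone_supPath
      have hψc : ∀ t ≤ t₀, -(p / α) < ψ t := fun t _ => hx.trans_le (hψx t)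
      have hρ0 : ρ 0 = ψ t₀ := by
        have := (h3 0).2
        beta_reduce at this
        rw [this, hψy, hd0, h1.total_zero]; simp
      have hagg0 : M.aggregate t₀ ω = 0 := hω.1
      refine ⟨concat t₀ ψ ρ, fun _ => ⟨?_, ?_, fun _ => ?_⟩⟩
      · refine isReservePath_concat hψ hψy h3 (fun t ht => ?_) fun s => ?_
        · rw [congrFun hpaid t, tsub_eq_zero_of_le ht, hd0, add_zero]
          refine le_antisymm (hagg0 ▸ haggm ht) ?_
          have := haggm (zero_le (a := t))
          simp only at this
          rwa [congrFun hagg 0, hgd.total_zero] at this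
        · rw [congrFun hpaid (t₀ + s), add_tsub_cancel_left, M.total_shift hgd, hagg0, sub_zero]
      · rw [hpaid]
        exact isAdmissiblePath_concat hdm hd0 h4 hψc hρ0
      · rw [hpaid, hittingTime_concat hψc hρ0, h5]
        exact discountedReturn_delay hdm t₀ _
    · obtain ⟨σ, hσ⟩ := exists_isReservePath (p := p) hr hrα x haggm
      have hpaid : (fun t => L'.paid t ω) = fun _ => 0 := by
        funext t; exact if_neg hω
      refine ⟨σ, fun _ => ⟨?_, ?_, fun h => absurd h hω⟩⟩
      · have : (fun t => M.aggregate t ω + L'.paid t ω) = fun t => M.aggregate t ω := by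
          funext t; rw [congrFun hpaid t, add_zero]
        rw [this]; exact hσ
      · rw [hpaid]; exact isAdmissiblePath_zero _ _
  choose σ hσ using hpath
  have hadm : IsAdmissible M p r α x L' fun t ω => σ ω t := by
    rw [isAdmissible_iff]
    filter_upwards [hgood] with ω hω
    exact ⟨(hσ ω hω).1, (hσ ω hω).2.1⟩
  refine le_trans ?_ (le_iSup₂_of_le L' (fun t ω => σ ω t) (le_iSup_of_le hadm le_rfl))
  have hAm' : MeasurableSet A := M.measurable_aggregate t₀ (measurableSet_singleton 0)
  rw [← hgint, expectedReturn_eq M hδ]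
  calc ENNReal.ofReal (Real.exp (-((lam + δ) * t₀))) * ∫⁻ ω, g (M.tail 0 0 ω) ∂μ
      = ENNReal.ofReal (Real.exp (-δ * t₀)) *
          (ENNReal.ofReal (Real.exp (-(lam * t₀))) * ∫⁻ ω, g (M.tail 0 0 ω) ∂μ) := by
        rw [← mul_assoc, ← ENNReal.ofReal_mul (Real.exp_pos _).le, ← Real.exp_add]
        congr 3; ring
    _ ≤ ENNReal.ofReal (Real.exp (-δ * t₀)) * ∫⁻ ω in A, g (M.shift t₀ ω) ∂μ := by
        gcongr
        exact M.mul_lintegral_tail_le hgood t₀ hg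
    _ = ∫⁻ ω, A.indicator (fun ω => ENNReal.ofReal (Real.exp (-δ * t₀)) * g (M.shift t₀ ω)) ω ∂μ := by
        rw [lintegral_indicator hAm', lintegral_const_mul' _ _ ENNReal.ofReal_ne_top]
    _ ≤ _ := by
        refine lintegral_mono_ae ?_
        filter_upwards [hgood, hGsh] with ω h1 h2
        by_cases hω : ω ∈ A
        · rw [indicator_of_mem hω]
          exact (hσ ω h1).2.2 ⟨hω, h2⟩
        · rw [indicator_of_notMem hω]
          exact zero_le

theorem exp_mul_value_le_value [IsProbabilityMeasure μ] (hp : 0 < p) (hr : 0 < r)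
    (hrα : r < α) (hδ : 0 < δ) (hgood : ∀ᵐ ω ∂μ, (M.tail 0 0 ω).IsGood) (hx : -(p / α) < x)
    (hxy : x ≤ y) : ∃ t₀ : ℝ≥0, t₀ * drift p r α x ≤ y - x ∧
      ENNReal.ofReal (Real.exp (-((lam + δ) * t₀))) * value M p r α δ y ≤ value M p r α δ x := by
  obtain ⟨ψ, t₀, hψ, hψx, hψy, ht₀⟩ := exists_isReservePath_zero hp hr hrα hx hxy
  refine ⟨t₀, ht₀, ?_⟩
  simp only [value, ENNReal.mul_iSup]
  exact iSup₂_le fun L R => iSup_le fun hLR =>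
    exp_mul_expectedReturn_le_value M hp hr hrα hδ hgood hx hψ hψx hψy hLR

/-! ### An additional lump sum at time zero -/

/-- Pay the lump sum `a` at time `0` in addition to `L`. -/
noncomputable def DividendProcess.addLump {m : MeasurableSpace Ω} {ℱ : Filtration ℝ≥0 m}
    (L : DividendProcess ℱ) {a : ℝ} (ha : 0 ≤ a) : DividendProcess ℱ where
  paid t ω := L.paid t ω + if 0 < t then a else 0
  paid_zero ω := by simp [L.paid_zero]
  monotone_paid ω := by
    refine (L.monotone_paid ω).add fun s t hst => ?_
    by_cases hs : 0 < s
    · simp [hs, hs.trans_le hst]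
    · simp only [hs, if_false]; split_ifs <;> simp [ha]
  leftCts_paid ω t := by
    refine (L.leftCts_paid ω t).add ?_
    rcases eq_or_ne t 0 with rfl | ht
    · have : Iic (0 : ℝ≥0) = {0} := by ext; simp
      rw [this]; exact continuousWithinAt_singleton
    · have ht' : 0 < t := pos_iff_ne_zero.2 ht
      refine ContinuousAt.continuousWithinAt ?_
      refine (continuousAt_const (y := a)).congr ?_
      filter_upwards [Ioi_mem_nhds ht'] with s hs
      simp [mem_Ioi.1 hs]
  predictable_paid := by
    refine StronglyMeasurable.add L.predictable_paid ?_
    refine Measurable.stronglyMeasurable ?_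
    have := measurable_predictable_indicator ℱ 0 (measurable_const (a := a))
    refine (congrArg _ (funext fun q => ?_)).mp this
    simp [indicator]

theorem discountedReturn_add_lump (hδ : 0 < δ) {l : ℝ≥0 → ℝ} (hl : Monotone l) (h0 : l 0 = 0)
    {a : ℝ} (ha : 0 ≤ a) (T : ℝ≥0∞) :
    discountedReturn δ (fun t => l t + if 0 < t then a else 0) T =
      discountedReturn δ l T + ENNReal.ofReal a := by
  have h1 : ENNReal.ofReal a =
      ∫⁻ t in Ioi (0 : ℝ), ENNReal.ofReal (δ * Real.exp (-δ * t)) * ENNReal.ofReal a := by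
    rw [lintegral_mul_const' _ _ ENNReal.ofReal_ne_top, lintegral_Ioi_exp hδ]
    simp
  rw [discountedReturn, discountedReturn]
  conv_rhs => rw [h1]
  rw [← lintegral_add_right _ (by fun_prop)]
  refine lintegral_congr fun t => ?_
  rw [paidThrough_add_const hl a ENNReal.toReal_nonneg,
    ENNReal.ofReal_add (paidThrough_nonneg hl h0 _) ha, mul_add]

/-- By left continuity the lump sum is deducted only after time `0`, so the two reserves differ at
time `0` alone, which no integral notices. -/
theorem isReservePath_add_lump {b : ℝ → ℝ} {x a : ℝ} {f ρ : ℝ≥0 → ℝ} (h : IsReservePath b x f ρ) :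
    IsReservePath b (x + a) (fun t => f t + if 0 < t then a else 0)
      (fun t => ρ t + if 0 < t then 0 else a) := by
  intro t
  have hcongr : ∀ s ∈ uIoc (0 : ℝ) t, b (ρ s.toNNReal) =
      b (ρ s.toNNReal + if 0 < s.toNNReal then 0 else a) := by
    intro s hs
    rw [uIoc_of_le t.coe_nonneg] at hs
    rw [if_pos (Real.toNNReal_pos.2 hs.1), add_zero]
  refine ⟨(h t).1.congr hcongr, ?_⟩
  beta_reduce
  rw [← intervalIntegral.integral_congr_ae (Eventually.of_forall hcongr), (h t).2]
  split_ifs <;> ring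

theorem value_add_le (hp : 0 < p) (hr : 0 < r) (hrα : r < α) (hδ : 0 < δ)
    (hgood : ∀ᵐ ω ∂μ, (M.tail 0 0 ω).IsGood) [IsProbabilityMeasure μ] (hx : -(p / α) ≤ x)
    (hxy : x ≤ y) : value M p r α δ x + ENNReal.ofReal (y - x) ≤ value M p r α δ y := by
  have hα := hr.trans hrα
  set c : ℝ := -(p / α) with hc
  have key : ∀ (L : DividendProcess M.filtration) (R : ℝ≥0 → Ω → ℝ), IsAdmissible M p r α x L R →
      expectedReturn M p α δ L R + ENNReal.ofReal (y - x) ≤ value M p r α δ y := by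
    intro L R hLR
    have ha : 0 ≤ y - x := sub_nonneg.2 hxy
    set R' : ℝ≥0 → Ω → ℝ := fun t ω => R t ω + if 0 < t then 0 else y - x with hR'
    have hboth : ∀ᵐ ω ∂μ, (IsReservePath (drift p r α) y
        (fun t => M.aggregate t ω + (L.addLump ha).paid t ω) (fun t => R' t ω) ∧
        IsAdmissiblePath c (fun t => (L.addLump ha).paid t ω) fun t => R' t ω) ∧
        hittingTime c (fun t => R' t ω) = hittingTime c fun t => R t ω := by
      filter_upwards [hgood, (isAdmissible_iff M).1 hLR] with ω hg h
      have hagg : (fun t => M.aggregate t ω) = fun t => (M.tail 0 0 ω).total t := by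
        funext t; exact M.aggregate_eq_total hg t
      have haggm : Monotone fun t => M.aggregate t ω := by rw [hagg]; exact hg.monotone_total
      have hR0 : R 0 ω = x := by
        have := (h.1 0).2
        beta_reduce at this
        rw [this, L.paid_zero, congrFun hagg 0, hg.total_zero]; simp
      have hT : hittingTime c (fun t => R' t ω) = hittingTime c fun t => R t ω := by
        apply le_antisymm
        -- If `R` starts at the critical level, `R'` may start above it. But `R` stays at or below
        -- the level, so `R'` is there at every later time and the infimum is unchanged.
        · refine le_iInf₂ fun s hs => le_of_forall_gt fun u hu => ?_
          obtain ⟨v, hsv, hvu⟩ := ENNReal.lt_iff_exists_nnreal_btwn.1 hu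
          have hsv' : s < v := by exact_mod_cast hsv
          have h1 : R v ω ≤ c := h.1.le_of_le hα.le (drift_le_posPart hp hr hrα)
            (haggm.add (L.monotone_paid ω)) hsv'.le hs
          refine (hittingTime_le (ρ := fun t => R' t ω) (t := v) ?_).trans_lt hvu
          simp only [hR', if_pos ((zero_le (a := s)).trans_lt hsv'), add_zero]
          exact h1
        · refine le_iInf₂ fun s hs => hittingTime_le (le_trans ?_ hs)
          simp only [hR']
          split_ifs <;> linarith
      refine ⟨⟨?_, fun t ht => ?_⟩, hT⟩
      · have := isReservePath_add_lump (a := y - x) h.1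
        simp only [add_assoc, add_sub_cancel] at this
        exact this
      · rw [hT] at ht
        have h1 := h.2 t ht
        have h2 : paidThrough (fun t => (L.addLump ha).paid t ω) t =
            paidThrough (fun t => L.paid t ω) t + (y - x) :=
          paidThrough_add_const (L.monotone_paid ω) _ t.coe_nonneg
        rw [h2]
        simp only [DividendProcess.addLump, hR']
        by_cases ht0 : 0 < t
        · simp only [ht0, if_true, add_zero]
          linarith
        -- At time `0` the two lump sums together are at most `(x - c) + (y - x) = y - c`.
        · obtain rfl : t = 0 := by simpa using ht0
          simp only [lt_irrefl, if_false, add_zero, hR0] at h1 ⊢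
          rw [max_eq_left (by linarith)] at h1
          exact le_trans (by linarith) (le_max_left _ _)
    have hadm : IsAdmissible M p r α y (L.addLump ha) R' :=
      (isAdmissible_iff M).2 (hboth.mono fun ω h => h.1)
    refine le_trans (le_of_eq ?_) (le_iSup₂_of_le (L.addLump ha) R' (le_iSup_of_le hadm le_rfl))
    rw [expectedReturn_eq M hδ, expectedReturn_eq M hδ]
    have e : ENNReal.ofReal (y - x) = ∫⁻ _, ENNReal.ofReal (y - x) ∂μ := by simp
    rw [e, ← lintegral_add_right _ measurable_const]
    refine lintegral_congr_ae ?_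
    filter_upwards [hboth] with ω h
    rw [h.2]
    exact (discountedReturn_add_lump hδ (L.monotone_paid ω) (L.paid_zero ω) ha _).symm
  -- Paying nothing is admissible, so the supremum is not over an empty family. This gives `y - x ≤
  -- V(y)`, needed to undo the truncated subtraction below.
  have hfree : ∃ (L : DividendProcess M.filtration) (R : ℝ≥0 → Ω → ℝ), IsAdmissible M p r α x L R := by
    have hpath : ∀ ω, ∃ σ : ℝ≥0 → ℝ, (M.tail 0 0 ω).IsGood →
        IsReservePath (drift p r α) x (fun t => M.aggregate t ω) σ := by
      intro ω
      by_cases hg : (M.tail 0 0 ω).IsGood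
      · have hagg : (fun t => M.aggregate t ω) = fun t => (M.tail 0 0 ω).total t := by
          funext t; exact M.aggregate_eq_total hg t
        obtain ⟨σ, hσ⟩ := exists_isReservePath (p := p) hr hrα x (hagg ▸ hg.monotone_total)
        exact ⟨σ, fun _ => hσ⟩
      · exact ⟨fun _ => 0, fun h => absurd h hg⟩
    choose σ hσ using hpath
    refine ⟨{
      paid := fun _ _ => 0
      paid_zero := fun _ => rfl
      monotone_paid := fun _ => monotone_const
      leftCts_paid := fun _ _ => continuousWithinAt_const
      predictable_paid := stronglyMeasurable_const }, fun t ω => σ ω t, ?_⟩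
    rw [isAdmissible_iff]
    filter_upwards [hgood] with ω hω
    refine ⟨?_, isAdmissiblePath_zero _ _⟩
    simpa only [add_zero] using hσ ω hω
  obtain ⟨L₀, R₀, h₀⟩ := hfree
  have hle : ENNReal.ofReal (y - x) ≤ value M p r α δ y := le_add_self.trans (key L₀ R₀ h₀)
  refine (add_le_add_left ?_ _).trans (tsub_add_cancel_of_le hle).le
  exact iSup₂_le fun L R => iSup_le fun hLR =>
    ENNReal.le_sub_of_add_le_right ENNReal.ofReal_ne_top (key L R hLR)

end

/-! ### The upper bound for the return -/

/-- An upper bound for the return of any strategy when the initial reserve exceeds the critical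
value by `η`. -/
noncomputable def returnBound (p r α δ η : ℝ) : ℝ≥0∞ :=
  ∫⁻ t in Ioi (0 : ℝ), ENNReal.ofReal (δ * Real.exp (-δ * t)) *
    ENNReal.ofReal (min ((η + p * t) * Real.exp (r * t)) (η * Real.exp (α * t)))

section Bound

variable {p r α δ : ℝ}

theorem returnBound_zero : returnBound p r α δ 0 = 0 := by
  simp [returnBound]

/-- Half of the gap `δ - r` absorbs the linear factor `η + p t`, the other half remains as
exponential decay. The bound depends on `η` only through `H`, so it also serves as a dominating
function. -/
theorem returnBound_integrand_le (hp : 0 < p) (hδ : 0 < δ) (hrδ : r < δ) {η H t : ℝ} (hη : 0 ≤ η)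
    (hH : η ≤ H) (ht : 0 ≤ t) :
    ENNReal.ofReal (δ * Real.exp (-δ * t)) *
      ENNReal.ofReal (min ((η + p * t) * Real.exp (r * t)) (η * Real.exp (α * t))) ≤
    ENNReal.ofReal (δ * (H + p / ((δ - r) / 2)) / ((δ - r) / 2)) *
      ENNReal.ofReal ((δ - r) / 2 * Real.exp (-((δ - r) / 2) * t)) := by
  set κ := (δ - r) / 2 with hκ
  have hκ0 : 0 < κ := by rw [hκ]; linarith
  have hH0 : 0 ≤ H := hη.trans hH
  have h1 : η + p * t ≤ (H + p / κ) * Real.exp (κ * t) := by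
    have e1 : p * t ≤ p / κ * Real.exp (κ * t) := by
      have := Real.add_one_le_exp (κ * t)
      calc p * t = p / κ * (κ * t) := by field_simp
        _ ≤ p / κ * Real.exp (κ * t) := by gcongr; linarith
    have e2 : H ≤ H * Real.exp (κ * t) :=
      le_mul_of_one_le_right hH0 (Real.one_le_exp (by positivity))
    linarith
  rw [← ENNReal.ofReal_mul (by positivity), ← ENNReal.ofReal_mul (by positivity)]
  apply ENNReal.ofReal_le_ofReal
  calc δ * Real.exp (-δ * t) * min ((η + p * t) * Real.exp (r * t)) (η * Real.exp (α * t))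
      ≤ δ * Real.exp (-δ * t) * ((H + p / κ) * Real.exp (κ * t) * Real.exp (r * t)) := by
        gcongr
        exact (min_le_left _ _).trans (by gcongr)
    _ = δ * (H + p / κ) * (Real.exp (-δ * t) * Real.exp (κ * t) * Real.exp (r * t)) := by ring
    _ = δ * (H + p / κ) * Real.exp (-κ * t) := by
        rw [← Real.exp_add, ← Real.exp_add]
        congr 2
        rw [hκ]; ring
    _ = δ * (H + p / κ) / κ * (κ * Real.exp (-κ * t)) := by field_simp

theorem lintegral_returnBound_dominant (hrδ : r < δ) (C : ℝ) :
    ∫⁻ t in Ioi (0 : ℝ), ENNReal.ofReal C *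
      ENNReal.ofReal ((δ - r) / 2 * Real.exp (-((δ - r) / 2) * t)) ≠ ∞ := by
  rw [lintegral_const_mul' _ _ ENNReal.ofReal_ne_top, lintegral_Ioi_exp (by linarith)]
  exact ENNReal.mul_ne_top ENNReal.ofReal_ne_top ENNReal.ofReal_ne_top

theorem returnBound_ne_top (hp : 0 < p) (hδ : 0 < δ) (hrδ : r < δ) {η : ℝ} (hη : 0 ≤ η) :
    returnBound p r α δ η ≠ ∞ :=
  ne_top_of_le_ne_top (lintegral_returnBound_dominant hrδ _) <|
    setLIntegral_mono' measurableSet_Ioi fun _ ht =>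
      returnBound_integrand_le hp hδ hrδ hη le_rfl (mem_Ioi.1 ht).le

/-- Pointwise convergence to `0` comes from the term `η e^{α t}` of the minimum, domination from the
other term. -/
theorem tendsto_returnBound_zero (hp : 0 < p) (hδ : 0 < δ) (hrδ : r < δ) :
    Tendsto (returnBound p r α δ) (𝓝[≥] 0) (𝓝 0) := by
  rw [← returnBound_zero (p := p) (r := r) (α := α) (δ := δ)]
  refine tendsto_lintegral_filter_of_dominated_convergence _
    (Eventually.of_forall fun η => by fun_prop) ?_ (lintegral_returnBound_dominant hrδ
      (δ * (1 + p / ((δ - r) / 2)) / ((δ - r) / 2))) (ae_of_all _ fun t => ?_)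
  · filter_upwards [self_mem_nhdsWithin, mem_nhdsWithin_of_mem_nhds (Iic_mem_nhds zero_lt_one)]
      with η h0 h1
    filter_upwards [ae_restrict_mem measurableSet_Ioi] with t ht
    exact returnBound_integrand_le hp hδ hrδ h0 h1 (mem_Ioi.1 ht).le
  · refine ENNReal.Tendsto.const_mul (ENNReal.tendsto_ofReal ?_) (Or.inr ENNReal.ofReal_ne_top)
    have : Continuous fun η => min ((η + p * t) * Real.exp (r * t)) (η * Real.exp (α * t)) := by
      fun_prop
    exact (this.tendsto 0).mono_left nhdsWithin_le_nhds

theorem discountedReturn_le_returnBound (hp : 0 < p) (hr : 0 < r) (hrα : r < α)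
    {x : ℝ} {y l ρ : ℝ≥0 → ℝ} (hy : Monotone y) (hy0 : 0 ≤ y 0) (hl : Monotone l) (hl0 : l 0 = 0)
    (hlc : ∀ t, ContinuousWithinAt l (Iic t) t)
    (h : IsReservePath (drift p r α) x (fun t => y t + l t) ρ)
    (hadm : IsAdmissiblePath (-(p / α)) l ρ) :
    discountedReturn δ l (hittingTime (-(p / α)) ρ) ≤
      returnBound p r α δ (max (x - -(p / α)) 0) := by
  have hα := hr.trans hrα
  refine setLIntegral_mono' measurableSet_Ioi fun t ht => ?_
  have ht0 : 0 ≤ t := (mem_Ioi.1 ht).le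
  set η := max (x - -(p / α)) 0
  have hη : 0 ≤ η := le_max_right _ _
  set T := hittingTime (-(p / α)) ρ
  set s : ℝ≥0 := (min (ENNReal.ofReal t) T).toNNReal with hs
  have hsc : (s : ℝ≥0∞) = min (ENNReal.ofReal t) T :=
    ENNReal.coe_toNNReal (ne_top_of_le_ne_top ENNReal.ofReal_ne_top (min_le_left _ _))
  have hsT : (s : ℝ≥0∞) ≤ T := hsc.le.trans (min_le_right _ _)
  have hst : (s : ℝ) ≤ t := ENNReal.toReal_le_of_le_ofReal ht0 (min_le_left _ _)
  have h1 := paidThrough_le hp.le hr.le (fun u _ => drift_le_linear hp hr hrα u) hy hy0 hl hl0 hlc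
    h hadm hsT
  have h2 := paidThrough_le le_rfl hα.le (fun u hu => drift_le_of_ge hp hr hrα hu) hy hy0 hl hl0 hlc
    h hadm hsT
  gcongr
  refine le_min (h1.trans ?_) (h2.trans ?_)
  · change (η + p * s) * _ ≤ _
    gcongr
  · change (η + 0 * s) * _ ≤ _
    rw [zero_mul, add_zero]
    gcongr

end Bound

/-! ### Increments and regularity of the value function -/

section Value

variable {Ω : Type*} [MeasurableSpace Ω] {μ : Measure Ω} [IsProbabilityMeasure μ] {lam : ℝ}
  {F : Measure ℝ} (M : ClaimModel μ lam F) {p r α δ : ℝ}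

theorem value_le_returnBound (hp : 0 < p) (hr : 0 < r) (hrα : r < α) (hδ : 0 < δ)
    (hgood : ∀ᵐ ω ∂μ, (M.tail 0 0 ω).IsGood) (x : ℝ) :
    value M p r α δ x ≤ returnBound p r α δ (max (x - -(p / α)) 0) := by
  refine iSup₂_le fun L R => iSup_le fun hLR => ?_
  rw [expectedReturn_eq M hδ]
  refine (lintegral_mono_ae (g := fun _ => returnBound p r α δ (max (x - -(p / α)) 0)) ?_).trans
    (by simp)
  filter_upwards [hgood, (isAdmissible_iff M).1 hLR] with ω hg h
  have hagg : (fun t => M.aggregate t ω) = fun t => (M.tail 0 0 ω).total t := by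
    funext t; exact M.aggregate_eq_total hg t
  refine discountedReturn_le_returnBound hp hr hrα (hagg ▸ hg.monotone_total) ?_
    (L.monotone_paid ω) (L.paid_zero ω) (L.leftCts_paid ω) h.1 h.2
  rw [congrFun hagg 0, hg.total_zero]

theorem realValue_add_le (hp : 0 < p) (hr : 0 < r) (hrα : r < α) (hδ : 0 < δ)
    (hgood : ∀ᵐ ω ∂μ, (M.tail 0 0 ω).IsGood) (hfin : ∀ x, value M p r α δ x ≠ ∞) {x y : ℝ}
    (hx : -(p / α) ≤ x) (hxy : x ≤ y) :
    realValue M p r α δ x + (y - x) ≤ realValue M p r α δ y := by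
  have := ENNReal.toReal_mono (hfin y) (value_add_le M hp hr hrα hδ hgood hx hxy)
  rwa [ENNReal.toReal_add (hfin x) ENNReal.ofReal_ne_top,
    ENNReal.toReal_ofReal (sub_nonneg.2 hxy)] at this

theorem realValue_sub_le (hp : 0 < p) (hr : 0 < r) (hrα : r < α) (hδ : 0 < δ) (hlam : 0 < lam)
    (hgood : ∀ᵐ ω ∂μ, (M.tail 0 0 ω).IsGood) (hfin : ∀ x, value M p r α δ x ≠ ∞) {x y : ℝ}
    (hx : -(p / α) < x) (hxy : x ≤ y) :
    realValue M p r α δ y - realValue M p r α δ x ≤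
      (lam + δ) / drift p r α x * realValue M p r α δ y * (y - x) := by
  obtain ⟨t₀, ht₀, h⟩ := exp_mul_value_le_value M hp hr hrα hδ hgood hx hxy
  have h1 := ENNReal.toReal_mono (hfin x) h
  rw [ENNReal.toReal_mul, ENNReal.toReal_ofReal (Real.exp_pos _).le] at h1
  change _ * realValue M p r α δ y ≤ realValue M p r α δ x at h1
  have hv : 0 ≤ realValue M p r α δ y := ENNReal.toReal_nonneg
  have hd := drift_pos hp hr hrα hx
  have h2 : (t₀ : ℝ) ≤ (y - x) / drift p r α x := (le_div_iff₀ hd).2 ht₀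
  have h3 : 1 - (lam + δ) * ((y - x) / drift p r α x) ≤ Real.exp (-((lam + δ) * t₀)) := by
    have h4 := Real.add_one_le_exp (-((lam + δ) * t₀))
    have h5 : (lam + δ) * (t₀ : ℝ) ≤ (lam + δ) * ((y - x) / drift p r α x) := by gcongr
    linarith
  have h6 := (mul_le_mul_of_nonneg_right h3 hv).trans h1
  calc realValue M p r α δ y - realValue M p r α δ x
      ≤ (lam + δ) * ((y - x) / drift p r α x) * realValue M p r α δ y := by linarith
    _ = _ := by ring

end Value

theorem one_le_deriv_of_add_sub_le {v : ℝ → ℝ} {c x : ℝ}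
    (h : ∀ x y, c ≤ x → x ≤ y → v x + (y - x) ≤ v y) (hx : c < x) (hd : DifferentiableAt ℝ v x) :
    1 ≤ deriv v x := by
  have h1 := hasDerivWithinAt_iff_tendsto_slope' (s := Ioi x) (by simp) |>.1
    hd.hasDerivAt.hasDerivWithinAt
  refine ge_of_tendsto h1 ?_
  filter_upwards [self_mem_nhdsWithin] with y hy
  have hxy : x < y := hy
  rw [slope_def_field, le_div_iff₀ (sub_pos.2 hxy)]
  linarith [h x y hx.le hxy.le]

/-- On a neighbourhood `(a, x + 1)` with `c < a < x` the increment bound has the constant `Λ / b a *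
v (x + 1)`, by monotonicity of `b` and `v`. -/
theorem locallyLipschitzOn_Ioi_of_sub_le {v b : ℝ → ℝ} {c Λ : ℝ} (hv : Monotone v)
    (hv0 : ∀ x, 0 ≤ v x) (hΛ : 0 ≤ Λ) (hb : Monotone b) (hb0 : ∀ x, c < x → 0 < b x)
    (h : ∀ x y, c < x → x ≤ y → v y - v x ≤ Λ / b x * v y * (y - x)) :
    LocallyLipschitzOn (Ioi c) v := by
  intro x hx
  have hx : c < x := hx
  obtain ⟨a, hca, hax⟩ := exists_between hx
  have ha := hb0 a hca
  have hC : 0 ≤ Λ / b a * v (x + 1) := mul_nonneg (div_nonneg hΛ ha.le) (hv0 _)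
  refine ⟨⟨_, hC⟩, Ioo a (x + 1), mem_nhdsWithin_of_mem_nhds (Ioo_mem_nhds hax (by linarith)), ?_⟩
  refine LipschitzOnWith.of_le_add_mul _ fun y hy z hz => ?_
  change v y ≤ v z + Λ / b a * v (x + 1) * dist y z
  rcases le_total y z with hyz | hyz
  · exact (hv hyz).trans (le_add_of_nonneg_right (mul_nonneg hC dist_nonneg))
  · have h1 := h z y (hca.trans hz.1) hyz
    have h2 : Λ / b z * v y * (y - z) ≤ Λ / b a * v (x + 1) * (y - z) := by
      have := hv hy.2.le
      have := hb hz.1.le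
      have := hv0 y
      have := sub_nonneg.2 hyz
      gcongr
    rw [Real.dist_eq, abs_of_nonneg (sub_nonneg.2 hyz)]
    linarith

end AbsoluteRuin

theorem theorem3p3 {Ω : Type*} [MeasurableSpace Ω] (μ : Measure Ω) [IsProbabilityMeasure μ]
    [μ.IsComplete] (p r α δ lam : ℝ) (hp : 0 < p) (hr : 0 < r) (hrα : r < α) (hrδ : r < δ)
    (hlam : 0 < lam) (F : Measure ℝ) [IsProbabilityMeasure F] (hF : F (Set.Iio 0) = 0)
    (M : AbsoluteRuin.ClaimModel μ lam F) :
    (∀ x : ℝ, AbsoluteRuin.value M p r α δ x ≠ ∞) ∧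
    (∀ x : ℝ, 0 ≤ AbsoluteRuin.realValue M p r α δ x) ∧
    Monotone (AbsoluteRuin.realValue M p r α δ) ∧
    ContinuousOn (AbsoluteRuin.realValue M p r α δ) (Set.Ici (-(p / α))) ∧
    LocallyLipschitzOn (Set.Ioi (-(p / α))) (AbsoluteRuin.realValue M p r α δ) ∧
    (∀ᵐ x ∂(volume.restrict (Set.Ioi (-(p / α)))),
      DifferentiableAt ℝ (AbsoluteRuin.realValue M p r α δ) x) ∧
    (∀ x ∈ Set.Ioi (-(p / α)), DifferentiableAt ℝ (AbsoluteRuin.realValue M p r α δ) x →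
      1 ≤ deriv (AbsoluteRuin.realValue M p r α δ) x) := by
  have hδ : 0 < δ := hr.trans hrδ
  have hgood := M.ae_isGood hlam hF
  have hle := AbsoluteRuin.value_le_returnBound M hp hr hrα hδ hgood
  have hbd : ∀ x : ℝ, AbsoluteRuin.returnBound p r α δ (max (x - -(p / α)) 0) ≠ ∞ := fun x =>
    AbsoluteRuin.returnBound_ne_top hp hδ hrδ (le_max_right _ _)
  have hfin : ∀ x, AbsoluteRuin.value M p r α δ x ≠ ∞ := fun x => ne_top_of_le_ne_top (hbd x) (hle x)
  have hadd := fun x y => AbsoluteRuin.realValue_add_le M hp hr hrα hδ hgood hfin (x := x) (y := y)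
  have hnonneg : ∀ x, 0 ≤ AbsoluteRuin.realValue M p r α δ x := fun x => ENNReal.toReal_nonneg
  have hzero : ∀ x ≤ -(p / α), AbsoluteRuin.realValue M p r α δ x = 0 := by
    intro x hx
    have := hle x
    rw [max_eq_right (sub_nonpos.2 hx), AbsoluteRuin.returnBound_zero, nonpos_iff_eq_zero] at this
    rw [AbsoluteRuin.realValue, this, ENNReal.toReal_zero]
  have hmono : Monotone (AbsoluteRuin.realValue M p r α δ) := by
    intro x y hxy
    rcases le_total x (-(p / α)) with hx | hx
    · rw [hzero x hx]; exact hnonneg y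
    · linarith [hadd x y hx hxy]
  have hlip : LocallyLipschitzOn (Ioi (-(p / α))) (AbsoluteRuin.realValue M p r α δ) :=
    AbsoluteRuin.locallyLipschitzOn_Ioi_of_sub_le hmono hnonneg (add_pos hlam hδ).le
      (AbsoluteRuin.monotone_drift (p := p) hr hrα) (fun _ => AbsoluteRuin.drift_pos hp hr hrα)
      fun _ _ => AbsoluteRuin.realValue_sub_le M hp hr hrα hδ hlam hgood hfin
  refine ⟨hfin, hnonneg, hmono, fun x hx => ?_, hlip, ae_restrict_of_ae hmono.ae_differentiableAt,
    fun x hx => AbsoluteRuin.one_le_deriv_of_add_sub_le hadd hx⟩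
  -- At the critical level, where the Lipschitz estimate degenerates, `V` is squeezed between `0`
  -- and `returnBound`.
  rcases (mem_Ici.1 hx).eq_or_lt with rfl | hx
  · rw [ContinuousWithinAt, hzero _ le_rfl]
    have h1 : Tendsto (fun x => max (x - -(p / α)) 0) (𝓝[≥] (-(p / α))) (𝓝[≥] 0) := by
      refine tendsto_nhdsWithin_iff.2 ⟨?_, Eventually.of_forall fun x => mem_Ici.2 (le_max_right _ _)⟩
      have : Continuous fun x : ℝ => max (x - -(p / α)) 0 := by fun_prop
      refine (this.tendsto' _ _ ?_).mono_left nhdsWithin_le_nhds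
      simp
    have h2 := (AbsoluteRuin.tendsto_returnBound_zero (α := α) hp hδ hrδ).comp h1
    have h3 : Tendsto (AbsoluteRuin.value M p r α δ) (𝓝[≥] (-(p / α))) (𝓝 0) :=
      tendsto_of_tendsto_of_tendsto_of_le_of_le tendsto_const_nhds h2 (fun _ => zero_le) hle
    exact (ENNReal.tendsto_toReal ENNReal.zero_ne_top).comp h3
  · exact (hlip.continuousOn.continuousAt (Ioi_mem_nhds hx)).continuousWithinAt
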